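/- Fix a countably infinite set $\mathsf{Var}$ of propositional variables. Let $\mathcal{L}$ be the propositional language with binary connectives $\wedge,\vee,\cdot,\to$ and constants $0,1$; for a set $I$ of unary connectives let $\mathcal{L}(I)=\mathcal{L}\cup I$, and let $Fm_{\mathcal{L}}$, $Fm_{\mathcal{L}(I)}$ be the corresponding sets of formulas over $\mathsf{Var}$. Write $\neg\varphi$ for $\varphi\to 0$ and $\varphi\leftrightarrow\psi$ for $(\varphi\to\psi)\wedge(\psi\to\varphi)$. **Logics.** $\mathbf{GBL}$ (generalized basic logic with exchange, weakening and falsum) is the logic over $\mathcal{L}$ with the rule modus ponens ($\varphi,\ \varphi\to\psi\vdash\psi$) and the axiom schemes (A1) $\varphi\to\varphi$; (A2) $(\varphi\to\psi)\to((\psi\to\chi)\to(\varphi\to\chi))$; (A3) $(\varphi\cdot\psi)\to(\psi\cdot\varphi)$; (A4) $(\varphi\cdot\psi)\to\psi$; (A5) $(\varphi\to(\psi\to\chi))\to((\varphi\cdot\psi)\to\chi)$; (A6) $((\varphi\cdot\psi)\to\chi)\to(\varphi\to(\psi\to\chi))$; (A7) $(\varphi\cdot(\varphi\to\psi))\to(\varphi\wedge\psi)$;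 (A8) $(\varphi\wedge\psi)\to(\varphi\cdot(\varphi\to\psi))$; (A9) $(\varphi\wedge\psi)\to(\psi\wedge\varphi)$; (A10) $\varphi\to(\varphi\vee\psi)$; (A11) $\psi\to(\varphi\vee\psi)$; (A12) $((\varphi\to\psi)\wedge(\chi\to\psi))\to((\varphi\vee\chi)\to\psi)$; (A13) $0\to\varphi$; together with the axiom $1$. The logic $\mathbf{S4\text{Ł}}(I)$ over $\mathcal{L}(I)$ has these axiom schemes (for formulas of $\mathcal{L}(I)$), the schemes $(\varphi\to\psi)\vee(\psi\to\varphi)$ and $\neg\neg\varphi\leftrightarrow\varphi$, and for every $\Box\in I$ the schemes $\Box(\varphi\to\psi)\to(\Box\varphi\to\Box\psi)$, $\Box(\varphi\cdot\psi)\leftrightarrow\Box\varphi\cdot\Box\psi$, $\Box(\varphi\wedge\psi)\leftrightarrow\Box\varphi\wedge\Box\psi$, $\Box1\leftrightarrow1$, $\Box0\leftrightarrow0$, $\Box\varphi\to\varphi$, $\Box\varphi\to\Box\Box\varphi$; its rules are modus ponens and necessitation $\varphi\vdash\Box\varphi$ for each $\Box\in I$. For a singleton $I=\{\Box\}$ this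 logic is denoted $\mathbf{S4\text{Ł}}$. $\mathbf{S4_t\text{Ł}}$ is $\mathbf{S4\text{Ł}}(\{G,H\})$ together with the schemes $\varphi\to G\neg H\neg\varphi$ and $\varphi\to H\neg G\neg\varphi$. For each of these logics $\mathbf{L}$, $\Gamma\vdash_{\mathbf{L}}\varphi$ means that $\varphi$ is derivable from the (possibly infinite) set of premises $\Gamma$, all rules being applicable to all derived formulas. **Algebras.** A GBL-algebra is an algebra $(A,\wedge,\vee,\cdot,\to,0,1)$ such that $(A,\wedge,\vee,0,1)$ is a bounded lattice, $(A,\cdot,1)$ is a commutative monoid, $x\cdot y\le z\iff x\le y\to z$, and $x\cdot(x\to y)=x\wedge y$. It is an MV-algebra if moreover $(x\to y)\vee(y\to x)=1$ and $\neg\neg x=x$, where $\neg x=x\to0$. An S4MV$(I)$-algebra is an MV-algebra equipped with a family of unary operations $\Box$ ($\Box\in I$), each of which preserves $\wedge,\cdot,0,1$ and is an interior operator. An S4MV-algebra is an S4MV$(\{\Box\})$-algebra. An S4$_t$MV-algebra is an S4MV$(\{G,H\})$-algebra such that $x\le G(y)\iff\neg H(\neg x)\le y$ for all $x,y$. Let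 $\mathsf{GBL}$, $\mathsf{S4MV}$, $\mathsf{S4_tMV}$ be the classes of GBL-algebras, S4MV-algebras and S4$_t$MV-algebras. For such a class $\mathsf{K}$ and a set $E\cup\{e\}$ of equations between formulas of its language, $E\vDash_{\mathsf{K}}e$ means that for every algebra in $\mathsf{K}$, every assignment of the variables that satisfies all equations in $E$ satisfies $e$. **Translations.** Define $M\colon Fm_{\mathcal{L}}\to Fm_{\mathcal{L}(\Box)}$ by $M(p)=\Box p$ for $p\in\mathsf{Var}$, $M(0)=0$, $M(1)=1$, $M(\varphi\star\psi)=M(\varphi)\star M(\psi)$ for $\star\in\{\wedge,\vee,\cdot\}$, and $M(\varphi\to\psi)=\Box(M(\varphi)\to M(\psi))$. Define $T\colon Fm_{\mathcal{L}}\to Fm_{\mathcal{L}(G,H)}$ by the same clauses with $G$ in place of $\Box$. Put $M(\Gamma)=\{M(\psi):\psi\in\Gamma\}$ and $T(\Gamma)=\{T(\psi):\psi\in\Gamma\}$. **Theorem.** Let $\Gamma\cup\{\varphi\}\subseteq Fm_{\mathcal{L}}$. Then: 1. $\{\psi\approx1:\psi\in\Gamma\}\vDash_{\mathsf{GBL}}\varphi\approx1\iff\{M(\psi)\approx1:\psi\in\Gamma\}\vDash_{\mathsf{S4MV}}M(\varphi)\approx1$.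 2. $\Gamma\vdash_{\mathbf{GBL}}\varphi\iff M(\Gamma)\vdash_{\mathbf{S4\text{Ł}}}M(\varphi)$. 3. $\{\psi\approx1:\psi\in\Gamma\}\vDash_{\mathsf{GBL}}\varphi\approx1\iff\{T(\psi)\approx1:\psi\in\Gamma\}\vDash_{\mathsf{S4_tMV}}T(\varphi)\approx1$. 4. $\Gamma\vdash_{\mathbf{GBL}}\varphi\iff T(\Gamma)\vdash_{\mathbf{S4_t\text{Ł}}}T(\varphi)$. -/

import Mathlib

universe u

namespace ModalGBL

/-! ## Languages and formulas -/

/-- Formulas of the language with binary connectives `∧, ∨, ·, →`, constants `0, 1` and a set `I`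
of unary connectives, over the countably infinite set `ℕ` of propositional variables. -/
inductive Fm (I : Type) : Type
  | var : ℕ → Fm I
  | zero : Fm I
  | one : Fm I
  | and : Fm I → Fm I → Fm I
  | or : Fm I → Fm I → Fm I
  | mul : Fm I → Fm I → Fm I
  | imp : Fm I → Fm I → Fm I
  | box : I → Fm I → Fm I

namespace Fm

variable {I : Type}

/-- The abbreviation `¬φ := φ → 0`. -/
def neg (φ : Fm I) : Fm I := imp φ zero

/-- The abbreviation `φ ↔ ψ := (φ → ψ) ∧ (ψ → φ)`. -/
def iff (φ ψ : Fm I) : Fm I := and (imp φ ψ) (imp ψ φ)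

end Fm

/-- The unary connective of the monomodal language. -/
inductive MonoConn : Type
  | box : MonoConn

/-- The unary connectives of the temporal language. -/
inductive TenseConn : Type
  | G : TenseConn
  | H : TenseConn

/-- Formulas of the basic language `ℒ` (no unary connectives). -/
abbrev FmL : Type := Fm Empty

/-- Formulas of `ℒ(□)`. -/
abbrev FmBox : Type := Fm MonoConn

/-- Formulas of `ℒ(G, H)`. -/
abbrev FmGH : Type := Fm TenseConn

/-! ## Hilbert calculi -/

open Fm in
/-- Axiom schemes of generalized basic logic with exchange, weakening and falsum. -/
inductive GBLAxiom {I : Type} : Fm I → Prop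
  | a1 (φ) : GBLAxiom (imp φ φ)
  | a2 (φ ψ χ) : GBLAxiom (imp (imp φ ψ) (imp (imp ψ χ) (imp φ χ)))
  | a3 (φ ψ) : GBLAxiom (imp (mul φ ψ) (mul ψ φ))
  | a4 (φ ψ) : GBLAxiom (imp (mul φ ψ) ψ)
  | a5 (φ ψ χ) : GBLAxiom (imp (imp φ (imp ψ χ)) (imp (mul φ ψ) χ))
  | a6 (φ ψ χ) : GBLAxiom (imp (imp (mul φ ψ) χ) (imp φ (imp ψ χ)))
  | a7 (φ ψ) : GBLAxiom (imp (mul φ (imp φ ψ)) (and φ ψ))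
  | a8 (φ ψ) : GBLAxiom (imp (and φ ψ) (mul φ (imp φ ψ)))
  | a9 (φ ψ) : GBLAxiom (imp (and φ ψ) (and ψ φ))
  | a10 (φ ψ) : GBLAxiom (imp φ (or φ ψ))
  | a11 (φ ψ) : GBLAxiom (imp ψ (or φ ψ))
  | a12 (φ ψ χ) : GBLAxiom (imp (and (imp φ ψ) (imp χ ψ)) (imp (or φ χ) ψ))
  | a13 (φ) : GBLAxiom (imp zero φ)
  /-- The constant `1` is truth; this is what makes `1` denote the unit of the algebras below. -/
  | truth : GBLAxiom one

open Fm in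
/-- Axiom schemes of infinite-valued Łukasiewicz logic. -/
inductive LukAxiom {I : Type} : Fm I → Prop
  | gbl {φ} : GBLAxiom φ → LukAxiom φ
  | a14 (φ ψ) : LukAxiom (or (imp φ ψ) (imp ψ φ))
  | a15 (φ) : LukAxiom (iff (neg (neg φ)) φ)

open Fm in
/-- Axiom schemes of the modal Łukasiewicz logic `Ł(I)`. -/
inductive LukModalAxiom {I : Type} : Fm I → Prop
  | luk {φ} : LukAxiom φ → LukModalAxiom φ
  | axK (i φ ψ) : LukModalAxiom (imp (box i (imp φ ψ)) (imp (box i φ) (box i ψ)))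
  | axP (i φ ψ) : LukModalAxiom (iff (box i (mul φ ψ)) (mul (box i φ) (box i ψ)))
  | axM (i φ ψ) : LukModalAxiom (iff (box i (and φ ψ)) (and (box i φ) (box i ψ)))
  | ax1 (i) : LukModalAxiom (iff (box i one) one)
  | ax0 (i) : LukModalAxiom (iff (box i zero) zero)

open Fm in
/-- Axiom schemes of `S4Ł(I)`. -/
inductive S4LukAxiom {I : Type} : Fm I → Prop
  | modal {φ} : LukModalAxiom φ → S4LukAxiom φ
  | axT (i φ) : S4LukAxiom (imp (box i φ) φ)
  | ax4 (i φ) : S4LukAxiom (imp (box i φ) (box i (box i φ)))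

open Fm in
/-- Axiom schemes of the temporal logic `S4ₜŁ`. -/
inductive S4tLukAxiom : FmGH → Prop
  | s4 {φ} : S4LukAxiom φ → S4tLukAxiom φ
  | axGP (φ) : S4tLukAxiom (imp φ (box .G (neg (box .H (neg φ)))))
  | axHF (φ) : S4tLukAxiom (imp φ (box .H (neg (box .G (neg φ)))))

/-- `Derives Ax Γ φ`: the formula `φ` has a derivation from the premises `Γ` in the Hilbert calculus
with axioms `Ax`, modus ponens, and the necessitation rule `φ ⊢ □φ` for each `□ ∈ I` (applicable
to any derived formula; there is no such rule if `I` is empty). -/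
inductive Derives {I : Type} (Ax : Fm I → Prop) (Γ : Set (Fm I)) : Fm I → Prop
  | ax {φ} : Ax φ → Derives Ax Γ φ
  | hyp {φ} : φ ∈ Γ → Derives Ax Γ φ
  | mp {φ ψ} : Derives Ax Γ φ → Derives Ax Γ (.imp φ ψ) → Derives Ax Γ ψ
  | nec {φ} (i : I) : Derives Ax Γ φ → Derives Ax Γ (.box i φ)

/-- The consequence relation `⊢` of generalized basic logic. -/
def GBLDerives (Γ : Set FmL) (φ : FmL) : Prop := Derives GBLAxiom Γ φ

/-- The consequence relation `⊢` of `S4Ł`. -/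
def S4LukDerives (Γ : Set FmBox) (φ : FmBox) : Prop := Derives S4LukAxiom Γ φ

/-- The consequence relation `⊢` of `S4ₜŁ`. -/
def S4tLukDerives (Γ : Set FmGH) (φ : FmGH) : Prop := Derives S4tLukAxiom Γ φ

/-! ## Algebras -/

/-- Bounded commutative integral residuated lattices; the residual is written `⇨`, the constant `0`
is `⊥`, and the monoid unit `1` is the top element. -/
class BCIRL (A : Type u) extends Lattice A, BoundedOrder A, CommMonoid A, HImp A where
  one_eq_top : (1 : A) = ⊤
  residuation (x y z : A) : x * y ≤ z ↔ x ≤ y ⇨ z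

/-- GBL-algebras (bounded and commutative). -/
class GBLAlgebra (A : Type u) extends BCIRL A where
  divisibility (x y : A) : x * (x ⇨ y) = x ⊓ y

/-- BL-algebras. -/
class BLAlgebra (A : Type u) extends GBLAlgebra A where
  prelinearity (x y : A) : (x ⇨ y) ⊔ (y ⇨ x) = 1

/-- MV-algebras. -/
class MVAlgebra (A : Type u) extends BLAlgebra A where
  neg_neg (x : A) : ((x ⇨ ⊥) ⇨ ⊥) = x

/-- An MV-algebra with operations `□`, `□ ∈ I`, is an MV(I)-algebra if each `□` is an
endomorphism for `∧, ·, 0, 1`. -/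
structure IsMVI {A : Type u} [MVAlgebra A] {I : Type} (box : I → A → A) : Prop where
  map_inf (i : I) (x y : A) : box i (x ⊓ y) = box i x ⊓ box i y
  map_mul (i : I) (x y : A) : box i (x * y) = box i x * box i y
  map_bot (i : I) : box i ⊥ = ⊥
  map_one (i : I) : box i 1 = 1

/-- An S4MV(I)-algebra is an MV(I)-algebra in which each `□` is an interior operator. -/
structure IsS4MVI {A : Type u} [MVAlgebra A] {I : Type} (box : I → A → A) : Prop
    extends IsMVI box where
  monotone (i : I) : Monotone (box i)
  le_self (i : I) (x : A) : box i x ≤ x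
  idem (i : I) (x : A) : box i (box i x) = box i x

/-- An S4ₜMV-algebra is an S4MV(G,H)-algebra in which `P x = ¬H¬x` is the lower residual of `G`. -/
structure IsS4tMV {A : Type u} [MVAlgebra A] (box : TenseConn → A → A) : Prop
    extends IsS4MVI box where
  residual (x y : A) : x ≤ box .G y ↔ (box .H (x ⇨ ⊥) ⇨ ⊥) ≤ y

/-! ## Equational consequence -/

/-- The value of a formula under an assignment `v` of the variables. -/
def Fm.eval {A : Type u} [BCIRL A] {I : Type} (box : I → A → A) (v : ℕ → A) : Fm I → A
  | .var p => v p
  | .zero => ⊥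
  | .one => 1
  | .and φ ψ => Fm.eval box v φ ⊓ Fm.eval box v ψ
  | .or φ ψ => Fm.eval box v φ ⊔ Fm.eval box v ψ
  | .mul φ ψ => Fm.eval box v φ * Fm.eval box v ψ
  | .imp φ ψ => Fm.eval box v φ ⇨ Fm.eval box v ψ
  | .box i φ => box i (Fm.eval box v φ)

/-- Equations, i.e. ordered pairs of formulas. -/
abbrev Equation (I : Type) : Type := Fm I × Fm I

/-- The equation `φ ≈ 1`. -/
def Fm.eqOne {I : Type} (φ : Fm I) : Equation I := (φ, .one)

/-- The equation `e` holds under the assignment `v`. -/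
def Equation.Holds {A : Type u} [BCIRL A] {I : Type} (box : I → A → A) (v : ℕ → A)
    (e : Equation I) : Prop :=
  e.1.eval box v = e.2.eval box v

/-- `E ⊨ e` for the variety of GBL-algebras: each assignment in each GBL-algebra satisfying all
equations in `E` satisfies `e`. -/
def GBLEntails (E : Set (Equation Empty)) (e : Equation Empty) : Prop :=
  ∀ (A : Type u) [GBLAlgebra A] (v : ℕ → A),
    (∀ e' ∈ E, Equation.Holds (fun i : Empty => i.elim) v e') →
      Equation.Holds (fun i : Empty => i.elim) v e

/-- `E ⊨ e` for the variety of S4MV-algebras. -/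
def S4MVEntails (E : Set (Equation MonoConn)) (e : Equation MonoConn) : Prop :=
  ∀ (A : Type u) [MVAlgebra A] (box : MonoConn → A → A), IsS4MVI box → ∀ v : ℕ → A,
    (∀ e' ∈ E, Equation.Holds box v e') → Equation.Holds box v e

/-- `E ⊨ e` for the variety of S4ₜMV-algebras. -/
def S4tMVEntails (E : Set (Equation TenseConn)) (e : Equation TenseConn) : Prop :=
  ∀ (A : Type u) [MVAlgebra A] (box : TenseConn → A → A), IsS4tMV box → ∀ v : ℕ → A,
    (∀ e' ∈ E, Equation.Holds box v e') → Equation.Holds box v e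

/-! ## The translations -/

/-- The translation of `ℒ` into `ℒ(I)` by means of the unary connective `i ∈ I`. -/
def translate {I : Type} (i : I) : FmL → Fm I
  | .var p => .box i (.var p)
  | .zero => .zero
  | .one => .one
  | .and φ ψ => .and (translate i φ) (translate i ψ)
  | .or φ ψ => .or (translate i φ) (translate i ψ)
  | .mul φ ψ => .mul (translate i φ) (translate i ψ)
  | .imp φ ψ => .box i (.imp (translate i φ) (translate i ψ))
  | .box e _ => e.elim

/-- The modal translation. -/
def M : FmL → FmBox := translate MonoConn.box

/-- The temporal translation. -/
def T : FmL → FmGH := translate TenseConn.G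

end ModalGBL

/-! Each logic is sound and complete for its algebras, also with infinitely many premises, through
Lindenbaum algebras (`GBLDerives_iff`, `S4LukDerives_iff`, `S4tLukDerives_iff`). So the claims about
derivability follow from those about algebras.

From GBL to modal algebras: the open elements of an S4MV(I)-algebra form a GBL-algebra with residual
`□(x → y)`, and a translated formula takes in the modal algebra the value that the original takes on
open elements (`OpenElement.eval_translate`).

Conversely, a GBL-algebra `A` is represented by open elements of a poset product of MV-algebras. The
indices are the values `p`, filters maximal among those omitting some element; `A/p` then has a
smallest nontrivial filter. Call an element other than `1` fixed if the generator `mono` of that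
filter acts trivially on it. The fixed elements form a down-set below all others (`Fixed.of_le`,
`fixed_le`); the others form a filter whose intervals `[d, 1]` are MV-chains (`imp_imp_eq`,
`le_or_le`). This filter may have no least element, so germs of families over `[d, 1]`, as `d`
decreases, provide one MV-algebra, in which all fixed elements become `⊥`.

Put `p` below `q` when everything not fixed modulo `p` lies in `q.F`. The representation preserves
the operations, with `→` going to `□(→)` (`represent_imp`), and sends only `1` to `1`. The interior
operators of an order and of its converse form a tense pair (`isS4tMV_posetBox`), so one embedding
serves both translations. -/

namespace ModalGBL

/-! ## Residuated lattices -/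

section BCIRL

variable {A : Type u} [BCIRL A]

theorem le_one' (x : A) : x ≤ 1 := BCIRL.one_eq_top (A := A) ▸ le_top

theorem mul_le_iff {x y z : A} : x * y ≤ z ↔ x ≤ y ⇨ z := BCIRL.residuation x y z

theorem mul_mono_left {x y : A} (h : x ≤ y) (z : A) : x * z ≤ y * z :=
  mul_le_iff.2 (h.trans (mul_le_iff.1 le_rfl))

instance : IsOrderedMonoid A where
  mul_le_mul_left _ _ h z := mul_mono_left h z

theorem mul_le_left (x y : A) : x * y ≤ x :=
  (mul_le_mul_right (le_one' y) x).trans (mul_one x).le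

theorem mul_le_right (x y : A) : x * y ≤ y := mul_comm x y ▸ mul_le_left y x

theorem imp_mul_le (x y : A) : (x ⇨ y) * x ≤ y := mul_le_iff.2 le_rfl

theorem mul_imp_le (x y : A) : x * (x ⇨ y) ≤ y := mul_comm x (x ⇨ y) ▸ imp_mul_le x y

theorem imp_eq_one {x y : A} : x ⇨ y = 1 ↔ x ≤ y := by
  rw [← one_mul x, mul_le_iff, one_mul]
  exact ⟨fun h => h.ge, fun h => (le_one' _).antisymm h⟩

theorem imp_self_eq (x : A) : x ⇨ x = 1 := imp_eq_one.2 le_rfl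

theorem le_imp_self (x y : A) : y ≤ x ⇨ y := mul_le_iff.1 (mul_le_left y x)

theorem one_imp (x : A) : (1 : A) ⇨ x = x :=
  ((mul_one _).ge.trans (imp_mul_le 1 x)).antisymm (le_imp_self 1 x)

theorem imp_mono_right {y z : A} (x : A) (h : y ≤ z) : x ⇨ y ≤ x ⇨ z :=
  mul_le_iff.1 ((imp_mul_le x y).trans h)

theorem imp_anti_left {x y : A} (h : x ≤ y) (z : A) : y ⇨ z ≤ x ⇨ z :=
  mul_le_iff.1 ((mul_le_mul_right h _).trans (imp_mul_le y z))

theorem mul_imp (x y z : A) : (x * y) ⇨ z = x ⇨ (y ⇨ z) := by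
  refine eq_of_forall_le_iff fun w => ?_
  rw [← mul_le_iff, ← mul_le_iff, ← mul_le_iff, mul_assoc]

theorem imp_left_comm (x y z : A) : x ⇨ (y ⇨ z) = y ⇨ (x ⇨ z) := by
  rw [← mul_imp, mul_comm, mul_imp]

theorem sup_mul (x y z : A) : (x ⊔ y) * z = x * z ⊔ y * z := by
  refine eq_of_forall_ge_iff fun w => ?_
  simp only [mul_le_iff, sup_le_iff]

theorem mul_sup (x y z : A) : x * (y ⊔ z) = x * y ⊔ x * z := by
  rw [mul_comm, sup_mul, mul_comm y, mul_comm z]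

theorem sup_imp (x y z : A) : (x ⊔ y) ⇨ z = (x ⇨ z) ⊓ (y ⇨ z) := by
  refine eq_of_forall_le_iff fun w => ?_
  rw [← mul_le_iff, le_inf_iff, ← mul_le_iff, ← mul_le_iff, mul_sup, sup_le_iff]

theorem le_imp_imp (x y : A) : x ≤ (x ⇨ y) ⇨ y := mul_le_iff.1 (mul_imp_le x y)

theorem imp_trans_le (x y z : A) : (x ⇨ y) * (y ⇨ z) ≤ x ⇨ z := by
  rw [← mul_le_iff, mul_assoc, mul_comm (y ⇨ z), ← mul_assoc]
  exact (mul_mono_left (imp_mul_le x y) _).trans (mul_imp_le y z)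

theorem eq_one_of_one_le {x : A} (h : 1 ≤ x) : x = 1 := (le_one' x).antisymm h

theorem pow_imp_eq {s m : A} (h : s ⇨ m = m) (n : ℕ) : s ^ n ⇨ m = m := by
  induction n with
  | zero => rw [pow_zero, one_imp]
  | succ n ih => rw [pow_succ, mul_imp, h, ih]

theorem pow_sup_eq_one {x y : A} (h : x ⊔ y = 1) (n : ℕ) : x ^ n ⊔ y = 1 := by
  induction n with
  | zero => exact eq_one_of_one_le (by rw [pow_zero]; exact le_sup_left)
  | succ n ih =>
    refine eq_one_of_one_le ?_
    calc (1 : A) = (x ^ n ⊔ y) * (x ⊔ y) := by rw [ih, h, one_mul]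
      _ = x ^ n * x ⊔ x ^ n * y ⊔ y * (x ⊔ y) := by rw [sup_mul, mul_sup]
      _ ≤ x ^ (n + 1) ⊔ y := by
        rw [pow_succ]
        exact sup_le (sup_le le_sup_left ((mul_le_right _ _).trans le_sup_right))
          ((mul_le_left _ _).trans le_sup_right)

end BCIRL

/-! ### Consequences of divisibility. -/

section GBL

variable {A : Type u} [GBLAlgebra A]

theorem mul_imp_self (x y : A) : x * (x ⇨ y) = x ⊓ y := GBLAlgebra.divisibility x y

theorem mul_imp_of_le {x y : A} (h : y ≤ x) : x * (x ⇨ y) = y := by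
  rw [mul_imp_self, inf_eq_right.2 h]

theorem imp_inf_self (x y : A) : x ⇨ (x ⊓ y) = x ⇨ y :=
  (imp_mono_right x inf_le_right).antisymm
    (mul_le_iff.1 (by rw [mul_comm, mul_imp_self]))

/-- Divisibility turns the meet into a product, and products distribute over joins. -/
theorem inf_sup_le (x y z : A) : x ⊓ (y ⊔ z) ≤ (x ⊓ y) ⊔ (x ⊓ z) := by
  rw [inf_comm, ← mul_imp_self, sup_mul]
  refine sup_le_sup (le_inf ?_ (mul_le_left _ _)) (le_inf ?_ (mul_le_left _ _))
  · exact (mul_le_mul_right (imp_anti_left le_sup_left x) y).trans (mul_imp_le y x)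
  · exact (mul_le_mul_right (imp_anti_left le_sup_right x) z).trans (mul_imp_le z x)

theorem inf_sup_distrib (x y z : A) : (x ⊓ y) ⊔ z = (x ⊔ z) ⊓ (y ⊔ z) := by
  let _ : DistribLattice A := DistribLattice.ofInfSupLe inf_sup_le
  exact sup_inf_right x y z

end GBL

/-! ## Quotients -/

/-- A preordered algebra satisfying the axioms of GBL-algebras up to the equivalence relation
induced by its preorder. -/
structure PreGBL (X : Type u) where
  le : X → X → Prop
  inf : X → X → X
  sup : X → X → X
  mul : X → X → X
  imp : X → X → X
  bot : X
  one : X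
  refl (x) : le x x
  trans {x y z} : le x y → le y z → le x z
  inf_le_left (x y) : le (inf x y) x
  inf_le_right (x y) : le (inf x y) y
  le_inf {x y z} : le x y → le x z → le x (inf y z)
  le_sup_left (x y) : le x (sup x y)
  le_sup_right (x y) : le y (sup x y)
  sup_le {x y z} : le x z → le y z → le (sup x y) z
  bot_le (x) : le bot x
  le_one (x) : le x one
  mul_comm (x y) : le (mul x y) (mul y x)
  mul_assoc_le (x y z) : le (mul (mul x y) z) (mul x (mul y z))
  mul_le_right (x y) : le (mul x y) y
  le_one_mul (x) : le x (mul one x)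
  residuation {x y z} : le (mul x y) z ↔ le x (imp y z)
  mul_imp_le (x y) : le (mul x (imp x y)) (inf x y)
  le_mul_imp (x y) : le (inf x y) (mul x (imp x y))

namespace PreGBL

variable {X : Type u} (P : PreGBL X)

theorem mul_mono {x x' y y'} (h : P.le x x') (k : P.le y y') : P.le (P.mul x y) (P.mul x' y') :=
  have mono {x x' y} (h : P.le x x') : P.le (P.mul x y) (P.mul x' y) :=
    P.residuation.2 (P.trans h (P.residuation.1 (P.refl _)))
  P.trans (mono h) (P.trans (P.mul_comm _ _) (P.trans (mono k) (P.mul_comm _ _)))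

theorem imp_mono {x x' y y'} (h : P.le x' x) (k : P.le y y') : P.le (P.imp x y) (P.imp x' y') :=
  P.residuation.1 (P.trans (P.mul_mono (P.refl _) h) (P.trans (P.residuation.2 (P.refl _)) k))

theorem le_mul_assoc (x y z) : P.le (P.mul x (P.mul y z)) (P.mul (P.mul x y) z) := by
  refine P.trans (P.mul_comm _ _) (P.trans (P.mul_assoc_le _ _ _) ?_)
  refine P.trans (P.mul_comm _ _) (P.trans (P.mul_assoc_le _ _ _) ?_)
  exact P.mul_comm _ _

/-- Mutual inequality. -/
def setoid : Setoid X where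
  r x y := P.le x y ∧ P.le y x
  iseqv := ⟨fun x => ⟨P.refl x, P.refl x⟩, fun h => ⟨h.2, h.1⟩,
    fun h k => ⟨P.trans h.1 k.1, P.trans k.2 h.2⟩⟩

/-- The GBL-algebra of classes of mutually comparable elements. -/
def Quo : Type u := Quotient P.setoid

variable {P} in
theorem sound_map₂ {f : X → X → X}
    (hf : ∀ {x x' y y'}, (P.le x x' ∧ P.le x' x) → (P.le y y' ∧ P.le y' y) →
      P.le (f x y) (f x' y')) (x x' : X) (hx : P.setoid x x') (y y' : X)
    (hy : P.setoid y y') : P.setoid (f x y) (f x' y') :=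
  ⟨hf hx hy, hf ⟨hx.2, hx.1⟩ ⟨hy.2, hy.1⟩⟩

/-- The class of an element. -/
def cls (x : X) : P.Quo := Quotient.mk P.setoid x

variable {P} in
theorem ind {p : P.Quo → Prop} (h : ∀ x, p (P.cls x)) (x : P.Quo) : p x := Quotient.ind h x

instance : PartialOrder P.Quo where
  le := Quotient.lift₂ P.le fun _ _ _ _ hx hy => propext
    ⟨fun h => P.trans hx.2 (P.trans h hy.1), fun h => P.trans hx.1 (P.trans h hy.2)⟩
  le_refl := ind P.refl
  le_trans := ind fun x => ind fun y => ind fun z => P.trans (x := x) (y := y) (z := z)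
  le_antisymm := ind fun _ => ind fun _ h k => Quotient.sound ⟨h, k⟩

variable {P} in
theorem cls_eq {x y : X} : P.cls x = P.cls y ↔ P.le x y ∧ P.le y x := le_antisymm_iff

instance : Lattice P.Quo where
  inf := Quotient.map₂ P.inf (sound_map₂ fun hx hy =>
    P.le_inf (P.trans (P.inf_le_left _ _) hx.1) (P.trans (P.inf_le_right _ _) hy.1))
  sup := Quotient.map₂ P.sup (sound_map₂ fun hx hy =>
    P.sup_le (P.trans hx.1 (P.le_sup_left _ _)) (P.trans hy.1 (P.le_sup_right _ _)))
  inf_le_left := ind fun x => ind fun y => P.inf_le_left x y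
  inf_le_right := ind fun x => ind fun y => P.inf_le_right x y
  le_inf := ind fun x => ind fun y => ind fun z => P.le_inf (x := x) (y := y) (z := z)
  le_sup_left := ind fun x => ind fun y => P.le_sup_left x y
  le_sup_right := ind fun x => ind fun y => P.le_sup_right x y
  sup_le := ind fun x => ind fun y => ind fun z => P.sup_le (x := x) (y := y) (z := z)

instance : BoundedOrder P.Quo where
  top := P.cls P.one
  le_top := ind P.le_one
  bot := P.cls P.bot
  bot_le := ind P.bot_le

instance : CommMonoid P.Quo where
  mul := Quotient.map₂ P.mul (sound_map₂ fun hx hy => P.mul_mono hx.1 hy.1)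
  one := P.cls P.one
  mul_comm := ind fun x => ind fun y => cls_eq.2 ⟨P.mul_comm x y, P.mul_comm y x⟩
  mul_assoc := ind fun x => ind fun y => ind fun z =>
    cls_eq.2 ⟨P.mul_assoc_le x y z, P.le_mul_assoc x y z⟩
  one_mul := ind fun x => cls_eq.2 ⟨P.mul_le_right _ x, P.le_one_mul x⟩
  mul_one := ind fun x => cls_eq.2 ⟨P.trans (P.mul_comm _ _) (P.mul_le_right _ x),
    P.trans (P.le_one_mul x) (P.mul_comm _ _)⟩

instance : GBLAlgebra P.Quo where
  himp := Quotient.map₂ P.imp (sound_map₂ fun hx hy => P.imp_mono hx.2 hy.1)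
  one_eq_top := rfl
  residuation := ind fun _ => ind fun _ => ind fun _ => P.residuation
  divisibility := ind fun x => ind fun y => cls_eq.2 ⟨P.mul_imp_le x y, P.le_mul_imp x y⟩

end PreGBL

/-! ## Implicative filters -/

/-- A set containing `1` and closed under modus ponens. -/
structure IsFilter {A : Type u} [BCIRL A] (F : Set A) : Prop where
  one : 1 ∈ F
  mp {x y} : x ∈ F → x ⇨ y ∈ F → y ∈ F

namespace IsFilter

section
variable {A : Type u} [BCIRL A] {F : Set A} (hF : IsFilter F)
include hF

theorem of_le {x y : A} (hx : x ∈ F) (h : x ≤ y) : y ∈ F :=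
  hF.mp hx (by rw [imp_eq_one.2 h]; exact hF.one)

theorem mul {x y : A} (hx : x ∈ F) (hy : y ∈ F) : x * y ∈ F :=
  hF.mp hy (hF.of_le hx (mul_le_iff.1 le_rfl))

theorem inf {x y : A} (hx : x ∈ F) (hy : y ∈ F) : x ⊓ y ∈ F :=
  hF.of_le (hF.mul hx hy) (le_inf (mul_le_left x y) (mul_le_right x y))

end

variable {A : Type u} [GBLAlgebra A] {F : Set A} (hF : IsFilter F)

/-- A GBL-algebra preordered by `x ⇨ y ∈ F`. -/
abbrev pre : PreGBL A where
  le x y := x ⇨ y ∈ F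
  inf := (· ⊓ ·)
  sup := (· ⊔ ·)
  mul := (· * ·)
  imp := (· ⇨ ·)
  bot := ⊥
  one := 1
  refl x := hF.of_le hF.one (imp_self_eq x).ge
  trans h k := hF.of_le (hF.mul h k) (imp_trans_le _ _ _)
  inf_le_left _ _ := hF.of_le hF.one (imp_eq_one.2 inf_le_left).ge
  inf_le_right _ _ := hF.of_le hF.one (imp_eq_one.2 inf_le_right).ge
  le_inf {x y z} h k := hF.of_le (hF.inf h k) <| mul_le_iff.1 <| le_inf
    ((mul_mono_left inf_le_left x).trans (imp_mul_le x y))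
    ((mul_mono_left inf_le_right x).trans (imp_mul_le x z))
  le_sup_left _ _ := hF.of_le hF.one (imp_eq_one.2 le_sup_left).ge
  le_sup_right _ _ := hF.of_le hF.one (imp_eq_one.2 le_sup_right).ge
  sup_le h k := hF.of_le (hF.inf h k) (sup_imp _ _ _).ge
  bot_le _ := hF.of_le hF.one (imp_eq_one.2 bot_le).ge
  le_one x := hF.of_le hF.one (imp_eq_one.2 (le_one' x)).ge
  mul_comm x y := hF.of_le hF.one (imp_eq_one.2 (mul_comm x y).le).ge
  mul_assoc_le x y z := hF.of_le hF.one (imp_eq_one.2 (mul_assoc x y z).le).ge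
  mul_le_right x y := hF.of_le hF.one (imp_eq_one.2 (mul_le_right x y)).ge
  le_one_mul x := hF.of_le hF.one (imp_eq_one.2 (one_mul x).ge).ge
  residuation {x y z} := by rw [mul_imp]
  mul_imp_le x y := hF.of_le hF.one (imp_eq_one.2 (mul_imp_self x y).le).ge
  le_mul_imp x y := hF.of_le hF.one (imp_eq_one.2 (mul_imp_self x y).ge).ge

theorem cls_le_iff {x y : A} : hF.pre.cls x ≤ hF.pre.cls y ↔ x ⇨ y ∈ F := Iff.rfl

theorem cls_eq_one {x : A} : hF.pre.cls x = 1 ↔ x ∈ F := by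
  have key : (1 : hF.pre.Quo) ≤ hF.pre.cls x ↔ x ∈ F :=
    (hF.cls_le_iff (x := 1)).trans (by rw [one_imp])
  exact ⟨fun h => key.1 h.ge, fun h => eq_one_of_one_le (key.2 h)⟩

theorem cls_pow (x : A) (n : ℕ) : hF.pre.cls (x ^ n) = hF.pre.cls x ^ n := by
  induction n with
  | zero => rw [pow_zero, pow_zero]; rfl
  | succ n ih => rw [pow_succ, pow_succ, ← ih]; rfl

end IsFilter

instance {A : Type u} [MVAlgebra A] {F : Set A} (hF : IsFilter F) : MVAlgebra hF.pre.Quo where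
  prelinearity := PreGBL.ind fun x => PreGBL.ind fun y =>
    congrArg hF.pre.cls (BLAlgebra.prelinearity x y)
  neg_neg := PreGBL.ind fun x => congrArg hF.pre.cls (MVAlgebra.neg_neg x)

instance {ι : Type u} (K : ι → Type u) [∀ i, MVAlgebra (K i)] : MVAlgebra (∀ i, K i) where
  one_eq_top := funext fun i => BCIRL.one_eq_top (A := K i)
  himp x y := fun i => x i ⇨ y i
  residuation x y z := forall_congr' fun i => BCIRL.residuation (x i) (y i) (z i)
  divisibility x y := funext fun i => GBLAlgebra.divisibility (x i) (y i)
  prelinearity x y := funext fun i => BLAlgebra.prelinearity (x i) (y i)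
  neg_neg x := funext fun i => MVAlgebra.neg_neg (x i)

/-! ## Subdirectly irreducible GBL-algebras -/

/-- A GBL-algebra with a smallest nontrivial filter, which is generated by `mono`. -/
class Monolithic (B : Type u) [GBLAlgebra B] where
  mono : B
  mono_ne : mono ≠ 1
  exists_pow_le (x : B) : x ≠ 1 → ∃ n : ℕ, x ^ n ≤ mono

namespace Monolithic

variable {B : Type u} [GBLAlgebra B] [Monolithic B]

/-- All powers of `s` act trivially on `m`, and some power lies below the monolith. So triviality of
the action need only be tested on `mono`. -/
theorem mono_imp_eq {s m : B} (hs : s ≠ 1) (h : s ⇨ m = m) : mono ⇨ m = m := by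
  obtain ⟨n, hn⟩ := exists_pow_le s hs
  exact ((imp_anti_left hn m).trans (pow_imp_eq h n).le).antisymm (le_imp_self _ _)

/-- Otherwise powers of both elements lie below `mono`, although powers of elements joining to `1`
still join to `1`. -/
theorem eq_one_or_eq_one {x y : B} (h : x ⊔ y = 1) : x = 1 ∨ y = 1 := by
  by_contra! hxy
  obtain ⟨n, hn⟩ := exists_pow_le x hxy.1
  obtain ⟨k, hk⟩ := exists_pow_le y hxy.2
  have := pow_sup_eq_one (sup_comm y _ ▸ pow_sup_eq_one h n) k
  exact mono_ne (eq_one_of_one_le (this ▸ sup_le hk hn))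

/-- The elements other than `1` on which the monolith acts trivially. -/
def Fixed (y : B) : Prop := y ≠ 1 ∧ mono ⇨ y = y

theorem not_fixed_mono : ¬ Fixed (mono : B) := fun h =>
  h.1 (h.2.symm.trans (imp_self_eq _))

/-- Applied first with `u = mono`, where `hm` is trivial, and later with any `u` that is not fixed.
-/
theorem le_of_imp_eq {u y : B} (hy : y ≠ 1) (h : u ⇨ y = y)
    (hm : ∀ m ≤ y, mono ⇨ m = m → u ⇨ m = m) : y ≤ u := by
  set m := u ⊓ y with hm_def
  set w := y ⇨ u with hw_def
  have hum : u ⇨ m = y := by rw [hm_def, imp_inf_self, h]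
  have hym : y ⇨ m = w := by rw [hm_def, inf_comm, imp_inf_self]
  have hwm : w ⇨ m = y := by
    refine ((imp_anti_left (le_imp_self y u) m).trans hum.le).antisymm ?_
    exact (le_imp_imp y m).trans (imp_anti_left hym.ge m)
  have hyw : y * w = m := by rw [hw_def, mul_imp_self, inf_comm]
  have hinf : w ⊓ y = m := by
    rw [← mul_imp_self]
    refine le_antisymm ?_ (le_trans (by rw [mul_comm, hyw]) (mul_le_mul_right (le_imp_self w y) w))
    rw [← hyw, mul_comm y]
    exact mul_le_mul_right ((imp_anti_left (le_imp_self y u) y).trans h.le) w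
  -- Residuation into `m` exchanges `w` and `y`, whose meet is `m`; hence their join acts trivially
  -- on `m`. Either the join is `1`, forcing `w = 1`, or the monolith acts trivially on `m`, and
  -- then `hm` gives `m = y`.
  have hs : (w ⊔ y) ⇨ m = m := by rw [sup_imp, hwm, hym, inf_comm, hinf]
  by_cases h1 : w ⊔ y = 1
  · exact imp_eq_one.1 ((eq_one_or_eq_one h1).resolve_right hy)
  · have := hm m inf_le_right (mono_imp_eq h1 hs)
    rw [hum] at this
    exact this ▸ inf_le_left

theorem Fixed.le_mono {y : B} (h : Fixed y) : y ≤ mono :=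
  le_of_imp_eq h.1 h.2 fun _ _ h => h

theorem Fixed.mono_mul {y : B} (h : Fixed y) : mono * y = y := by
  conv_lhs => rw [← h.2]
  exact mul_imp_of_le h.le_mono

/-- By divisibility `mono ⇨ z` is a multiple of `y`, so it is unchanged by multiplication with
`mono`; but that product is `z`. -/
theorem Fixed.of_le {y z : B} (h : Fixed y) (hz : z ≤ y) : Fixed z := by
  refine ⟨fun h1 => h.1 (eq_one_of_one_le (h1 ▸ hz)), le_antisymm ?_ (le_imp_self _ _)⟩
  have hty : mono ⇨ z ≤ y := (imp_mono_right _ hz).trans h.2.le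
  have h1 : mono * (mono ⇨ z) = z := mul_imp_of_le (hz.trans h.le_mono)
  have h2 : y * (y ⇨ (mono ⇨ z)) = mono ⇨ z := mul_imp_of_le hty
  have : mono * (mono ⇨ z) = mono ⇨ z := by
    conv_lhs => rw [← h2, ← mul_assoc, h.mono_mul, h2]
  exact (this.symm.trans h1).le

theorem not_fixed_of_le {x y : B} (h : ¬ Fixed x) (hxy : x ≤ y) : ¬ Fixed y :=
  fun hy => h (hy.of_le hxy)

theorem not_fixed_one : ¬ Fixed (1 : B) := fun h => h.1 rfl

theorem eq_one_of_mono_imp {x : B} (h : ¬ Fixed x) (hx : mono ⇨ x = x) : x = 1 :=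
  by_contra fun h1 => h ⟨h1, hx⟩

/-- If `d = x * y` were fixed, `mono` would act trivially on `x ⇨ d`, which lies above `y` and so is
not fixed. Hence it is `1`, and `x ≤ d` would be fixed. -/
theorem not_fixed_mul {x y : B} (hx : ¬ Fixed x) (hy : ¬ Fixed y) : ¬ Fixed (x * y) := by
  intro hd
  set d := x * y with hd_def
  have hy' : ¬ Fixed (x ⇨ d) := not_fixed_of_le hy (mul_le_iff.1 (by rw [mul_comm]))
  have h : mono ⇨ (x ⇨ d) = x ⇨ d := by rw [imp_left_comm, hd.2]
  have hxd : x ≤ d := imp_eq_one.1 (eq_one_of_mono_imp hy' h)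
  exact hx (hd.of_le hxd)

/-- The monolith acts trivially on `(u ⇨ y) ⇨ y`, which lies above `u` and so is not fixed; only `1`
has both properties. -/
theorem imp_fixed {u y : B} (hu : ¬ Fixed u) (hy : Fixed y) : u ⇨ y = y := by
  have h : mono ⇨ ((u ⇨ y) ⇨ y) = (u ⇨ y) ⇨ y := by rw [imp_left_comm, hy.2]
  have hu' : ¬ Fixed ((u ⇨ y) ⇨ y) := not_fixed_of_le hu (le_imp_imp u y)
  exact (imp_eq_one.1 (eq_one_of_mono_imp hu' h)).antisymm (le_imp_self _ _)

theorem fixed_le {u y : B} (hu : ¬ Fixed u) (hy : Fixed y) : y ≤ u :=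
  le_of_imp_eq hy.1 (imp_fixed hu hy) fun _ hm _ => imp_fixed hu (hy.of_le hm)

theorem mul_fixed {u y : B} (hu : ¬ Fixed u) (hy : Fixed y) : u * y = y := by
  conv_lhs => rw [← imp_fixed hu hy]
  exact mul_imp_of_le (fixed_le hu hy)

/-- With `t` the double negation, `t ⇨ x` acts trivially on `x ⇨ d`. If `t ⇨ x` is not `1`, then so
does `mono`, which forces `x ⇨ d = 1` and `x = d`. -/
theorem imp_imp_eq {x d : B} (hd : ¬ Fixed d) (hdx : d ≤ x) : (x ⇨ d) ⇨ d = x := by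
  set t := (x ⇨ d) ⇨ d with ht
  have hxt : x ≤ t := le_imp_imp x d
  have htd : t ⇨ d = x ⇨ d := (imp_anti_left hxt d).antisymm (le_imp_imp _ d)
  have hx : t * (t ⇨ x) = x := mul_imp_of_le hxt
  have hr : (t ⇨ x) ⇨ (x ⇨ d) = x ⇨ d := by
    conv_lhs => rw [← htd, ← mul_imp, mul_comm, hx]
  by_cases h : t ⇨ x = 1
  · exact (imp_eq_one.1 h).antisymm hxt
  · have := eq_one_of_mono_imp (not_fixed_of_le hd (le_imp_self x d)) (mono_imp_eq h hr)
    rw [ht, this, one_imp]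
    exact hdx.antisymm (imp_eq_one.1 this)

/-- By double negation over `x ⊓ y`, the element `(x ⇨ y) ⊔ (y ⇨ x)` acts trivially on `x ⊓ y`. As
`x ⊓ y` is not fixed, either the join is `1`, and `1` is join-irreducible, or `x ⊓ y = 1`. -/
theorem le_or_le {x y : B} (hx : ¬ Fixed x) (hy : ¬ Fixed y) : x ≤ y ∨ y ≤ x := by
  rw [← imp_eq_one, ← imp_eq_one (x := y)]
  by_contra! h
  have hm : ¬ Fixed (x ⊓ y) :=
    not_fixed_of_le (not_fixed_mul hx hy) (le_inf (mul_le_left x y) (mul_le_right x y))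
  have h1 : (x ⇨ y) ⇨ (x ⊓ y) = x := by
    rw [← imp_inf_self x y]; exact imp_imp_eq hm inf_le_left
  have h2 : (y ⇨ x) ⇨ (x ⊓ y) = y := by
    rw [← imp_inf_self y x, inf_comm y x]; exact imp_imp_eq hm inf_le_right
  have hs : ((x ⇨ y) ⊔ (y ⇨ x)) ⇨ (x ⊓ y) = x ⊓ y := by rw [sup_imp, h1, h2]
  by_cases hs1 : (x ⇨ y) ⊔ (y ⇨ x) = 1
  · exact (eq_one_or_eq_one hs1).elim h.1 h.2
  · have h3 := eq_one_of_mono_imp hm (mono_imp_eq hs1 hs)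
    have : y = 1 := eq_one_of_one_le (h3 ▸ inf_le_right)
    exact h.1 (imp_eq_one.2 (this ▸ le_one' x))

/-! ### The intervals above unfixed elements as MV-algebras. -/

/-- The filter of elements that are not fixed. -/
abbrev Upper (B : Type u) [GBLAlgebra B] [Monolithic B] : Type u := {d : B // ¬ Fixed d}

/-- The interval `[d, 1]`. -/
def Cut (d : Upper B) : Type u := {x : B // d.1 ≤ x}

namespace Cut

variable {d : Upper B}

instance : Lattice (Cut d) := inferInstanceAs (Lattice (Set.Ici d.1))

/-- The projection `x ↦ x ⊔ d` onto the interval `[d, 1]`. -/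
def proj (d : Upper B) (x : B) : Cut d := ⟨x ⊔ d.1, le_sup_right⟩

instance : BoundedOrder (Cut d) where
  top := ⟨⊤, le_top⟩
  le_top _ := le_top (α := B)
  bot := ⟨d.1, le_rfl⟩
  bot_le x := x.2

/-- The product is truncated at `d`, since `x * y` may leave the interval. -/
instance : CommMonoid (Cut d) where
  mul x y := proj d (x.1 * y.1)
  one := ⟨1, le_one' _⟩
  mul_comm x y := Subtype.ext (congrArg (· ⊔ d.1) (mul_comm x.1 y.1))
  mul_assoc x y z := Subtype.ext <| by
    change (x.1 * y.1 ⊔ d.1) * z.1 ⊔ d.1 = x.1 * (y.1 * z.1 ⊔ d.1) ⊔ d.1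
    rw [sup_mul, mul_sup, mul_assoc, sup_assoc, sup_assoc, sup_eq_right.2 (mul_le_left d.1 _),
      sup_eq_right.2 (mul_le_right _ d.1)]
  one_mul x := Subtype.ext ((congrArg (· ⊔ d.1) (one_mul x.1)).trans (sup_eq_left.2 x.2))
  mul_one x := Subtype.ext ((congrArg (· ⊔ d.1) (mul_one x.1)).trans (sup_eq_left.2 x.2))

instance : MVAlgebra (Cut d) where
  himp x y := ⟨x.1 ⇨ y.1, y.2.trans (le_imp_self _ _)⟩
  one_eq_top := Subtype.ext BCIRL.one_eq_top
  residuation x y z := sup_le_iff.trans ((and_iff_left z.2).trans mul_le_iff)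
  divisibility x y := Subtype.ext <| (congrArg (· ⊔ d.1) (mul_imp_self x.1 y.1)).trans
    (sup_eq_left.2 (le_inf x.2 y.2))
  prelinearity x y := Subtype.ext <| by
    have h := le_or_le (not_fixed_of_le d.2 x.2) (not_fixed_of_le d.2 y.2)
    rw [← imp_eq_one, ← imp_eq_one (x := y.1)] at h
    change (x.1 ⇨ y.1) ⊔ (y.1 ⇨ x.1) = 1
    exact eq_one_of_one_le
      (h.elim (fun h => h ▸ le_sup_left) (fun h => h ▸ le_sup_right))
  neg_neg x := Subtype.ext (imp_imp_eq d.2 x.2)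

theorem proj_mul (x y : B) : proj d (x * y) = proj d x * proj d y :=
  Subtype.ext <| by
    change _ = (x ⊔ d.1) * (y ⊔ d.1) ⊔ d.1
    rw [sup_mul, mul_sup, sup_assoc, sup_assoc,
      sup_eq_right.2 (mul_le_left d.1 _), sup_eq_right.2 (mul_le_right _ d.1)]
    rfl

theorem proj_inf (x y : B) : proj d (x ⊓ y) = proj d x ⊓ proj d y :=
  Subtype.ext (inf_sup_distrib x y d.1)

theorem proj_sup (x y : B) : proj d (x ⊔ y) = proj d x ⊔ proj d y :=
  Subtype.ext (sup_sup_distrib_right x y d.1)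

theorem proj_one : proj d (1 : B) = 1 := Subtype.ext (sup_eq_left.2 (le_one' _))

theorem proj_of_le {x : B} (h : x ≤ d.1) : proj d x = ⊥ := Subtype.ext (sup_eq_right.2 h)

theorem proj_imp {x y : B} (hx : d.1 ≤ x) (hy : d.1 ≤ y) :
    proj d (x ⇨ y) = proj d x ⇨ proj d y := Subtype.ext <| by
  change _ = (x ⊔ d.1) ⇨ (y ⊔ d.1)
  rw [sup_eq_left.2 hx, sup_eq_left.2 hy]
  exact sup_eq_left.2 (hy.trans (le_imp_self _ _))

end Cut

/-! ### Gluing the intervals into one MV-algebra of germs. -/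

/-- The families in `∏ [d, 1]` that are eventually `1` as `d` decreases. -/
def eventuallyOne (B : Type u) [GBLAlgebra B] [Monolithic B] : Set (∀ d : Upper B, Cut d) :=
  {f | ∃ d₀ : Upper B, ∀ d : Upper B, d.1 ≤ d₀.1 → f d = 1}

theorem isFilter_eventuallyOne : IsFilter (eventuallyOne B) where
  one := ⟨⟨1, not_fixed_one⟩, fun _ _ => rfl⟩
  mp := by
    rintro x y ⟨a, ha⟩ ⟨b, hb⟩
    -- The product is an unfixed element below both thresholds.
    refine ⟨⟨a.1 * b.1, not_fixed_mul a.2 b.2⟩, fun d hd => ?_⟩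
    have h := hb d (hd.trans (mul_le_right _ _))
    have h' : x d ⇨ y d = 1 := h
    rwa [ha d (hd.trans (mul_le_left _ _)), one_imp] at h'

/-- The MV-algebra of germs of elements of the intervals `[d, 1]`. -/
abbrev Germ (B : Type u) [GBLAlgebra B] [Monolithic B] : Type u :=
  (isFilter_eventuallyOne (B := B)).pre.Quo

/-- The germ of the family `x ⊔ d`. -/
def germ (x : B) : Germ B := (isFilter_eventuallyOne (B := B)).pre.cls fun d => Cut.proj d x

theorem germ_mul (x y : B) : germ (x * y) = germ x * germ y :=
  congrArg (PreGBL.cls _) (funext fun _ => Cut.proj_mul x y)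

theorem germ_inf (x y : B) : germ (x ⊓ y) = germ x ⊓ germ y :=
  congrArg (PreGBL.cls _) (funext fun _ => Cut.proj_inf x y)

theorem germ_sup (x y : B) : germ (x ⊔ y) = germ x ⊔ germ y :=
  congrArg (PreGBL.cls _) (funext fun _ => Cut.proj_sup x y)

theorem germ_one : germ (1 : B) = 1 :=
  congrArg (PreGBL.cls _) (funext fun _ => Cut.proj_one)

theorem germ_fixed {x : B} (h : Fixed x) : germ x = ⊥ :=
  congrArg (PreGBL.cls _) (funext fun d => Cut.proj_of_le (fixed_le d.2 h))

theorem germ_bot : germ (⊥ : B) = ⊥ :=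
  congrArg (PreGBL.cls _) (funext fun _ => Cut.proj_of_le bot_le)

theorem germ_le {x y : B} : germ x ≤ germ y ↔
    ∃ d₀ : Upper B, ∀ d : Upper B, d.1 ≤ d₀.1 → x ≤ y ⊔ d.1 := by
  refine Iff.trans (IsFilter.cls_le_iff _) (exists_congr fun d₀ => forall₂_congr fun d _ => ?_)
  refine Iff.trans (imp_eq_one (x := Cut.proj d x) (y := Cut.proj d y)) ?_
  exact sup_le_iff.trans (and_iff_left le_sup_right)

/-- Once `d` is below `x * y`, projecting to `[d, 1]` changes neither `x` nor `y`. -/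
theorem germ_imp {x y : B} (hx : ¬ Fixed x) (hy : ¬ Fixed y) :
    germ (x ⇨ y) = germ x ⇨ germ y := by
  refine PreGBL.cls_eq.2 ⟨?_, ?_⟩ <;>
  refine ⟨⟨x * y, not_fixed_mul hx hy⟩, fun d hd => imp_eq_one.2 ?_⟩
  · exact (Cut.proj_imp (hd.trans (mul_le_left _ _)) (hd.trans (mul_le_right _ _))).le
  · exact (Cut.proj_imp (hd.trans (mul_le_left _ _)) (hd.trans (mul_le_right _ _))).ge

theorem le_of_germ_le {x y : B} (hy : ¬ Fixed y) (h : germ x ≤ germ y) : x ≤ y := by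
  obtain ⟨d, hd⟩ := germ_le.1 h
  have := hd ⟨y * d.1, not_fixed_mul hy d.2⟩ (mul_le_right _ _)
  rwa [sup_eq_left.2 (mul_le_left _ _)] at this

theorem germ_eq_one {x : B} : germ x = 1 ↔ x = 1 := by
  refine ⟨fun h => ?_, fun h => h ▸ germ_one⟩
  obtain ⟨d, hd⟩ := germ_le.1 (germ_one.trans h.symm).le
  by_cases hx : Fixed x
  · have h1 := hd ⟨d.1 * mono, not_fixed_mul d.2 not_fixed_mono⟩ (mul_le_left _ _)
    have h2 := fixed_le (not_fixed_mul d.2 not_fixed_mono) hx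
    rw [sup_eq_right.2 h2] at h1
    exact absurd (eq_one_of_one_le (h1.trans (mul_le_right _ _))) mono_ne
  · exact eq_one_of_one_le (le_of_germ_le hx (germ_one.trans h.symm).le)

end Monolithic

/-! ## Values -/

/-- A filter that is maximal among those omitting a given element. -/
structure Value (A : Type u) [GBLAlgebra A] where
  F : Set A
  isFilter : IsFilter F
  c : A
  c_notMem : c ∉ F
  exists_pow_imp_mem (x : A) : x ∉ F → ∃ n : ℕ, x ^ n ⇨ c ∈ F

section

variable {A : Type u} [GBLAlgebra A]

theorem IsFilter.generate {F : Set A} (hF : IsFilter F) (x : A) :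
    IsFilter {y | ∃ n : ℕ, x ^ n ⇨ y ∈ F} where
  one := ⟨0, by rw [pow_zero, imp_self_eq]; exact hF.one⟩
  mp := by
    rintro y z ⟨n, hn⟩ ⟨k, hk⟩
    refine ⟨n + k, hF.of_le (hF.mul hn hk) ?_⟩
    rw [pow_add, mul_comm (x ^ n), mul_imp, ← mul_le_iff, mul_assoc, mul_comm (x ^ k ⇨ _)]
    refine (mul_le_mul_right (mul_imp_le _ _) _).trans ?_
    exact imp_trans_le _ _ _

theorem Value.exists_of_notMem {F : Set A} (hF : IsFilter F) {c : A} (hc : c ∉ F) :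
    ∃ p : Value A, F ⊆ p.F ∧ p.c = c := by
  have hchain (C : Set (Set A)) (hC : C ⊆ {G : Set A | IsFilter G ∧ c ∉ G})
      (hchain : IsChain (· ⊆ ·) C) (hne : C.Nonempty) : IsFilter (⋃₀ C) ∧ c ∉ ⋃₀ C := by
    refine ⟨⟨?_, ?_⟩, ?_⟩
    · obtain ⟨s, hs⟩ := hne
      exact ⟨s, hs, (hC hs).1.one⟩
    · rintro x y ⟨s, hs, hx⟩ ⟨t, ht, hy⟩
      obtain h | h := hchain.total hs ht
      · exact ⟨t, ht, (hC ht).1.mp (h hx) hy⟩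
      · exact ⟨s, hs, (hC hs).1.mp hx (h hy)⟩
    · rintro ⟨s, hs, h⟩
      exact (hC hs).2 h
  obtain ⟨G, hFG, hG⟩ := zorn_subset_nonempty {G : Set A | IsFilter G ∧ c ∉ G}
    (fun C hC hch hne => ⟨⋃₀ C, hchain C hC hch hne, fun _ hs => Set.subset_sUnion_of_mem hs⟩)
    F ⟨hF, hc⟩
  refine ⟨⟨G, hG.prop.1, c, hG.prop.2, fun x hx => ?_⟩, hFG, rfl⟩
  by_contra hn
  have hle : G ⊆ {y | ∃ n : ℕ, x ^ n ⇨ y ∈ G} :=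
    fun y hy => ⟨0, by rwa [pow_zero, one_imp]⟩
  -- If the filter generated by `G` and `x` omitted `c`, maximality would put it inside `G`,
  -- although it contains `x`.
  exact hx (hG.le_of_ge ⟨hG.prop.1.generate x, hn⟩ hle
    ⟨1, by rw [pow_one, imp_self_eq]; exact hG.prop.1.one⟩)

namespace Value

/-- The quotient by a value. -/
abbrev Quo (p : Value A) : Type u := p.isFilter.pre.Quo

/-- The class of an element modulo a value. -/
abbrev cls (p : Value A) (x : A) : p.Quo := p.isFilter.pre.cls x

theorem cls_eq_one {p : Value A} {x : A} : p.cls x = 1 ↔ x ∈ p.F := p.isFilter.cls_eq_one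

instance (p : Value A) : Monolithic p.Quo where
  mono := p.cls p.c
  mono_ne h := p.c_notMem (p.cls_eq_one.1 h)
  exists_pow_le := PreGBL.ind fun x hx =>
    (p.exists_pow_imp_mem x fun h => hx (p.cls_eq_one.2 h)).imp fun n hn => by
      rw [← p.isFilter.cls_pow]; exact hn

open Monolithic

/-- The filter of elements that are not fixed modulo `p`. -/
def upper (p : Value A) : Set A := {x | ¬ Fixed (p.cls x)}

theorem subset_upper (p : Value A) : p.F ⊆ p.upper := fun _ hx =>
  fun h => h.1 (p.cls_eq_one.2 hx)

theorem c_mem_upper (p : Value A) : p.c ∈ p.upper := not_fixed_mono (B := p.Quo)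

theorem isFilter_upper (p : Value A) : IsFilter p.upper where
  one := not_fixed_one (B := p.Quo)
  mp {x y} hx hy := not_fixed_of_le (not_fixed_mul hx hy) (mul_imp_le (p.cls x) (p.cls y))

/-- The strict order of values. -/
def Below (p q : Value A) : Prop := p.upper ⊆ q.F

theorem Below.trans {p q r : Value A} (h : p.Below q) (k : q.Below r) : p.Below r :=
  fun _ hx => k (q.subset_upper (h hx))

end Value

end

/-! ## Poset products -/

section PosetProduct

variable {ι : Type u} {K : ι → Type u} [∀ i, MVAlgebra (K i)]

open Classical in
/-- The interior operator of a poset product. -/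
noncomputable def posetBox (r : ι → ι → Prop) (f : ∀ i, K i) : ∀ i, K i :=
  fun i => if ∀ j, r i j → f j = 1 then f i else ⊥

theorem posetBox_of_forall {r : ι → ι → Prop} {f : ∀ i, K i} {i : ι} (h : ∀ j, r i j → f j = 1) :
    posetBox r f i = f i := if_pos h

theorem posetBox_of_not_forall {r : ι → ι → Prop} {f : ∀ i, K i} {i : ι}
    (h : ¬ ∀ j, r i j → f j = 1) : posetBox r f i = ⊥ := if_neg h

theorem posetBox_le (r : ι → ι → Prop) (f : ∀ i, K i) : posetBox r f ≤ f := fun i => by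
  by_cases h : ∀ j, r i j → f j = 1
  · exact (posetBox_of_forall h).le
  · exact (posetBox_of_not_forall h).trans_le bot_le

theorem mul_eq_one {A : Type u} [BCIRL A] {x y : A} : x * y = 1 ↔ x = 1 ∧ y = 1 :=
  ⟨fun h => ⟨eq_one_of_one_le (h ▸ mul_le_left x y), eq_one_of_one_le (h ▸ mul_le_right x y)⟩,
    fun h => by rw [h.1, h.2, one_mul]⟩

theorem inf_eq_one {A : Type u} [BCIRL A] {x y : A} : x ⊓ y = 1 ↔ x = 1 ∧ y = 1 :=
  ⟨fun h => ⟨eq_one_of_one_le (h ▸ inf_le_left), eq_one_of_one_le (h ▸ inf_le_right)⟩,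
    fun h => by rw [h.1, h.2, inf_idem]⟩

theorem mul_bot' {A : Type u} [BCIRL A] (x : A) : x * ⊥ = ⊥ := le_bot_iff.1 (mul_le_right x ⊥)

theorem bot_mul' {A : Type u} [BCIRL A] (x : A) : ⊥ * x = ⊥ := le_bot_iff.1 (mul_le_left ⊥ x)

theorem isS4MVI_posetBox {I : Type} {r : I → ι → ι → Prop}
    (hr : ∀ n i j k, r n i j → r n j k → r n i k) :
    IsS4MVI fun n (f : ∀ i, K i) => posetBox (r n) f where
  map_inf n f g := funext fun i => by
    change _ = posetBox (r n) f i ⊓ posetBox (r n) g i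
    by_cases hf : ∀ j, r n i j → f j = 1
    · by_cases hg : ∀ j, r n i j → g j = 1
      · rw [posetBox_of_forall hf, posetBox_of_forall hg, posetBox_of_forall]
        · rfl
        · exact fun j hj => inf_eq_one.2 ⟨hf j hj, hg j hj⟩
      · rw [posetBox_of_not_forall hg, inf_bot_eq, posetBox_of_not_forall]
        exact fun h => hg fun j hj => (inf_eq_one.1 (h j hj)).2
    · rw [posetBox_of_not_forall hf, bot_inf_eq, posetBox_of_not_forall]
      exact fun h => hf fun j hj => (inf_eq_one.1 (h j hj)).1
  map_mul n f g := funext fun i => by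
    change _ = posetBox (r n) f i * posetBox (r n) g i
    by_cases hf : ∀ j, r n i j → f j = 1
    · by_cases hg : ∀ j, r n i j → g j = 1
      · rw [posetBox_of_forall hf, posetBox_of_forall hg, posetBox_of_forall]
        · rfl
        · exact fun j hj => mul_eq_one.2 ⟨hf j hj, hg j hj⟩
      · rw [posetBox_of_not_forall hg, mul_bot', posetBox_of_not_forall]
        exact fun h => hg fun j hj => (mul_eq_one.1 (h j hj)).2
    · rw [posetBox_of_not_forall hf, bot_mul', posetBox_of_not_forall]
      exact fun h => hf fun j hj => (mul_eq_one.1 (h j hj)).1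
  map_bot n := le_bot_iff.1 (posetBox_le _ _)
  map_one n := funext fun i => posetBox_of_forall fun _ _ => rfl
  monotone n f g hfg i := by
    change posetBox (r n) f i ≤ posetBox (r n) g i
    by_cases hf : ∀ j, r n i j → f j = 1
    · rw [posetBox_of_forall hf, posetBox_of_forall fun j hj =>
        eq_one_of_one_le (hf j hj ▸ hfg j)]
      exact hfg i
    · rw [posetBox_of_not_forall hf]; exact bot_le
  le_self n f := posetBox_le _ _
  idem n f := funext fun i => by
    by_cases hf : ∀ j, r n i j → f j = 1
    · refine posetBox_of_forall fun j hj => ?_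
      rw [posetBox_of_forall fun k hk => hf k (hr n i j k hj hk), hf j hj]
    · rw [posetBox_of_not_forall hf]
      exact le_bot_iff.1 ((posetBox_le _ _ i).trans (posetBox_of_not_forall hf).le)

/-- The family of relations interpreting the temporal connectives: a relation and its converse. -/
def tenseRel (r : ι → ι → Prop) : TenseConn → ι → ι → Prop
  | .G => r
  | .H => fun i j => r j i

theorem imp_bot_eq_one {A : Type u} [BCIRL A] {x : A} : x ⇨ ⊥ = 1 ↔ x = ⊥ :=
  imp_eq_one.trans le_bot_iff

/-- Explicitly, `¬H¬f` has value `f i` at `i` if `f` is `⊥` at every `j` with `r j i`, and value `1`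
otherwise (`hP`, `hP'`). -/
theorem isS4tMV_posetBox {r : ι → ι → Prop} (hr : ∀ i j k, r i j → r j k → r i k) :
    IsS4tMV fun n (f : ∀ i, K i) => posetBox (tenseRel r n) f where
  toIsS4MVI := isS4MVI_posetBox fun n => match n with
    | .G => hr
    | .H => fun i j k hij hjk => hr k j i hjk hij
  residual f g := by
    have hP (i) (h : ∀ j, r j i → f j = ⊥) :
        posetBox (fun i j => r j i) (f ⇨ ⊥) i ⇨ ⊥ = f i := by
      rw [posetBox_of_forall (f := f ⇨ ⊥) fun j hj => imp_bot_eq_one.2 (h j hj)]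
      exact MVAlgebra.neg_neg (f i)
    have hP' (i) (h : ¬ ∀ j, r j i → f j = ⊥) :
        posetBox (fun i j => r j i) (f ⇨ ⊥) i ⇨ ⊥ = 1 := by
      rw [posetBox_of_not_forall (f := f ⇨ ⊥) fun h' => h fun j hj => imp_bot_eq_one.1 (h' j hj),
        imp_self_eq]
    constructor
    · intro hfg i
      change posetBox (fun i j => r j i) (f ⇨ ⊥) i ⇨ ⊥ ≤ g i
      by_cases h : ∀ j, r j i → f j = ⊥
      · exact (hP i h).trans_le ((hfg i).trans (posetBox_le _ _ i))
      · rw [hP' i h]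
        push Not at h
        obtain ⟨j, hj, hfj⟩ := h
        by_contra hg
        refine hfj (le_bot_iff.1 ((hfg j).trans (posetBox_of_not_forall fun h' => ?_).le))
        exact hg (h' i hj).ge
    · intro hfg i
      change f i ≤ posetBox r g i
      have hfg' (i) : posetBox (fun i j => r j i) (f ⇨ ⊥) i ⇨ ⊥ ≤ g i := hfg i
      have hle : f i ≤ g i := by
        by_cases h : ∀ j, r j i → f j = ⊥
        · exact (hP i h).ge.trans (hfg' i)
        · exact (le_one' _).trans ((hP' i h).ge.trans (hfg' i))
      by_cases h : ∀ j, r i j → g j = 1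
      · rwa [posetBox_of_forall h]
      · push Not at h
        obtain ⟨j, hj, hgj⟩ := h
        have : ∀ k, r k j → f k = ⊥ := by
          by_contra h'
          exact hgj (eq_one_of_one_le ((hP' j h').ge.trans (hfg' j)))
        rw [this i hj]; exact bot_le

end PosetProduct

/-! ## The embedding of a GBL-algebra into a poset product of MV-algebras -/

section Embedding

open Monolithic

variable {A : Type u} [GBLAlgebra A]

/-- The poset product representation. -/
def represent (x : A) (p : Value A) : Germ p.Quo := germ (p.cls x)

theorem represent_eq_one {x : A} {p : Value A} : represent x p = 1 ↔ x ∈ p.F :=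
  germ_eq_one.trans p.cls_eq_one

theorem represent_eq_bot {x : A} {p : Value A} (h : x ∉ p.upper) : represent x p = ⊥ :=
  germ_fixed (not_not.1 h)

theorem represent_one : represent (1 : A) = 1 := funext fun _ => germ_one

theorem represent_bot : represent (⊥ : A) = ⊥ := funext fun _ => germ_bot

theorem represent_mul (x y : A) : represent (x * y) = represent x * represent y :=
  funext fun p => germ_mul (p.cls x) (p.cls y)

theorem represent_inf (x y : A) : represent (x ⊓ y) = represent x ⊓ represent y :=
  funext fun p => germ_inf (p.cls x) (p.cls y)

theorem represent_sup (x y : A) : represent (x ⊔ y) = represent x ⊔ represent y :=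
  funext fun p => germ_sup (p.cls x) (p.cls y)

theorem represent_mono {x y : A} {p : Value A} (h : x ⇨ y ∈ p.F) : represent x p ≤ represent y p := by
  have h' : p.cls x ≤ p.cls y := h
  refine inf_eq_left.1 ((germ_inf _ _).symm.trans ?_)
  rw [inf_eq_left.2 h']; rfl

theorem represent_injective_one {x : A} (h : represent x = 1) : x = 1 := by
  by_contra hx
  obtain ⟨p, -, hp⟩ := Value.exists_of_notMem (F := {(1 : A)})
    ⟨rfl, fun {a b} ha hb => by
      rw [Set.mem_singleton_iff] at *; rwa [ha, one_imp] at hb⟩ hx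
  exact p.c_notMem (hp ▸ represent_eq_one.1 (congrFun h p))

/-- At each `p`, either `x` is unfixed and hence represented by `1` at all larger values, or it is
represented by `⊥` at `p` itself. -/
theorem posetBox_represent (x : A) : posetBox Value.Below (represent x) = represent x :=
  funext fun p => by
    by_cases hx : x ∈ p.upper
    · exact posetBox_of_forall fun q hq => represent_eq_one.2 (hq hx)
    · refine le_antisymm (posetBox_le _ _ p) ?_
      rw [represent_eq_bot hx]; exact bot_le

/-- A value of `x ⇨ y` separates `x` from `y`. -/
theorem exists_not_represent_le {F : Set A} (hF : IsFilter F) {x y : A} (h : x ⇨ y ∉ F) :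
    ∃ q : Value A, F ⊆ q.F ∧ ¬ represent x q ≤ represent y q := by
  obtain ⟨q, hq, hc⟩ := Value.exists_of_notMem hF h
  refine ⟨q, hq, fun hle => q.c_notMem ?_⟩
  -- Modulo a value of `x ⇨ y`, the class of `x ⇨ y` is the monolith, which is never fixed.
  have hcU : ¬ Fixed (q.cls x ⇨ q.cls y) := by
    have := q.c_mem_upper
    rwa [hc] at this
  suffices h : q.cls x ≤ q.cls y by rw [hc]; exact h
  by_cases hx : Fixed (q.cls x)
  · have := imp_mul_le (q.cls x) (q.cls y)
    rwa [mul_fixed hcU hx] at this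
  by_cases hy : Fixed (q.cls y)
  · rw [imp_fixed hx hy] at hcU
    exact absurd hy hcU
  exact le_of_germ_le hy hle

/-- If `x ⇨ y` is unfixed modulo `p`, it belongs to every larger value and the residual at `p` is
the pointwise one. If it is fixed, both sides are `⊥`, because a value above `p` separates `x` from
`y`. -/
theorem represent_imp (x y : A) :
    represent (x ⇨ y) = posetBox Value.Below (represent x ⇨ represent y) := funext fun p => by
  by_cases hU : x ⇨ y ∈ p.upper
  · rw [posetBox_of_forall (f := represent x ⇨ represent y)
      fun q (hq : p.Below q) => imp_eq_one.2 (represent_mono (hq hU))]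
    -- A fixed `x` absorbs the unfixed `x ⇨ y`, whence `x ≤ y` modulo `p`. For unfixed `x`, a fixed
    -- `y` would make `x ⇨ y = y` fixed, so `germ_imp` applies.
    by_cases hx : Fixed (p.cls x)
    · have h1 : x ⇨ y ∈ p.F := by
        have := imp_mul_le (p.cls x) (p.cls y)
        exact (mul_fixed (u := p.cls x ⇨ p.cls y) hU hx).ge.trans this
      exact (represent_eq_one.2 h1).trans (imp_eq_one.2 (represent_mono h1)).symm
    · exact germ_imp hx fun hy => hU (by
        change Fixed (p.cls x ⇨ p.cls y)
        rwa [imp_fixed hx hy])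
  · rw [represent_eq_bot hU, posetBox_of_not_forall]
    obtain ⟨q, hq, h⟩ := exists_not_represent_le p.isFilter_upper hU
    exact fun h' => h (imp_eq_one.1 (h' q hq))

end Embedding

/-! ## Semantics of the translations -/

section OpenElements

variable {A : Type u} [MVAlgebra A] {I : Type} {box : I → A → A}

/-- The elements fixed by the interior operator `box i`. -/
def OpenElement (_ : IsS4MVI box) (i : I) : Type u := {x : A // box i x = x}

namespace OpenElement

variable {h : IsS4MVI box} {i : I}

theorem box_sup (x y : OpenElement h i) : box i (x.1 ⊔ y.1) = x.1 ⊔ y.1 :=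
  (h.le_self i _).antisymm (sup_le (x.2.ge.trans (h.monotone i le_sup_left))
    (y.2.ge.trans (h.monotone i le_sup_right)))

instance : Lattice (OpenElement h i) where
  __ := (inferInstance : PartialOrder {x : A // box i x = x})
  inf x y := ⟨x.1 ⊓ y.1, by rw [h.map_inf, x.2, y.2]⟩
  sup x y := ⟨x.1 ⊔ y.1, box_sup x y⟩
  inf_le_left _ _ := inf_le_left (α := A)
  inf_le_right _ _ := inf_le_right (α := A)
  le_inf _ _ _ := le_inf (α := A)
  le_sup_left _ _ := le_sup_left (α := A)
  le_sup_right _ _ := le_sup_right (α := A)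
  sup_le _ _ _ := sup_le (α := A)

instance : BoundedOrder (OpenElement h i) where
  top := ⟨⊤, by rw [← BCIRL.one_eq_top, h.map_one]⟩
  le_top _ := le_top (α := A)
  bot := ⟨⊥, h.map_bot i⟩
  bot_le _ := bot_le (α := A)

instance : CommMonoid (OpenElement h i) where
  mul x y := ⟨x.1 * y.1, by rw [h.map_mul, x.2, y.2]⟩
  one := ⟨1, h.map_one i⟩
  mul_comm x y := Subtype.ext (mul_comm x.1 y.1)
  mul_assoc x y z := Subtype.ext (mul_assoc x.1 y.1 z.1)
  one_mul x := Subtype.ext (one_mul x.1)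
  mul_one x := Subtype.ext (mul_one x.1)

instance : GBLAlgebra (OpenElement h i) where
  himp x y := ⟨box i (x.1 ⇨ y.1), h.idem i _⟩
  one_eq_top := Subtype.ext BCIRL.one_eq_top
  residuation x y z := by
    change x.1 * y.1 ≤ z.1 ↔ x.1 ≤ box i (y.1 ⇨ z.1)
    rw [mul_le_iff]
    exact ⟨fun hx => x.2.ge.trans (h.monotone i hx), fun hx => hx.trans (h.le_self i _)⟩
  divisibility x y := Subtype.ext <| by
    change x.1 * box i (x.1 ⇨ y.1) = x.1 ⊓ y.1
    conv_lhs => rw [← x.2]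
    -- As `x` is open, `x · □(x → y) = □(x · (x → y)) = □(x ∧ y)`, and the last is `x ∧ y`.
    rw [← h.map_mul, x.2, mul_imp_self, h.map_inf, x.2, y.2]

theorem eval_translate (v : ℕ → A) (φ : FmL) :
    (φ.eval (A := OpenElement h i) (fun e : Empty => e.elim)
      (fun p => ⟨box i (v p), h.idem i _⟩)).1 =
      (translate i φ).eval box v := by
  induction φ with
  | var p => rfl
  | zero => rfl
  | one => rfl
  | and φ ψ hφ hψ => exact congrArg₂ (· ⊓ ·) hφ hψ
  | or φ ψ hφ hψ => exact congrArg₂ (· ⊔ ·) hφ hψ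
  | mul φ ψ hφ hψ => exact congrArg₂ (· * ·) hφ hψ
  | imp φ ψ hφ hψ => exact congrArg₂ (fun x y => box i (x ⇨ y)) hφ hψ
  | box e => exact e.elim

end OpenElement

end OpenElements

/-! ### Transfer of equational consequence along the translations. -/

theorem holds_translate_of_GBLEntails {Γ : Set FmL} {φ : FmL}
    (H : GBLEntails.{u} {e | ∃ ψ ∈ Γ, e = ψ.eqOne} φ.eqOne) {A : Type u} [MVAlgebra A] {I : Type}
    {box : I → A → A} (h : IsS4MVI box) (i : I) (v : ℕ → A)
    (hv : ∀ ψ ∈ Γ, (translate i ψ).eval box v = 1) : (translate i φ).eval box v = 1 := by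
  rw [← OpenElement.eval_translate (h := h)]
  refine congrArg Subtype.val (H (OpenElement h i) _ ?_)
  rintro _ ⟨ψ, hψ, rfl⟩
  exact Subtype.ext ((OpenElement.eval_translate v ψ).trans (hv ψ hψ))

theorem eval_translate_represent {A : Type u} [GBLAlgebra A] {I : Type} (i : I)
    {box : I → (∀ p : Value A, Monolithic.Germ p.Quo) → ∀ p : Value A, Monolithic.Germ p.Quo}
    (hbox : box i = posetBox Value.Below) (v : ℕ → A) (φ : FmL) :
    (translate i φ).eval box (fun p => represent (v p)) =
      represent (φ.eval (fun e : Empty => e.elim) v) := by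
  induction φ with
  | var p => exact (congrFun hbox _).trans (posetBox_represent _)
  | zero => exact represent_bot.symm
  | one => exact represent_one.symm
  | and φ ψ hφ hψ => exact (congrArg₂ (· ⊓ ·) hφ hψ).trans (represent_inf _ _).symm
  | or φ ψ hφ hψ => exact (congrArg₂ (· ⊔ ·) hφ hψ).trans (represent_sup _ _).symm
  | mul φ ψ hφ hψ => exact (congrArg₂ (· * ·) hφ hψ).trans (represent_mul _ _).symm
  | imp φ ψ hφ hψ =>
    exact (congrArg₂ (fun x y => box i (x ⇨ y)) hφ hψ).trans
      ((congrFun hbox _).trans (represent_imp _ _).symm)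
  | box e => exact e.elim

/-- Translated formulas mention only connective `i`, so the remaining operators may be chosen
freely; this covers both languages at once. -/
theorem GBLEntails_of_translate {Γ : Set FmL} {φ : FmL} {I : Type} (i : I)
    (H : ∀ (A : Type u) [GBLAlgebra A] (v : ℕ → ∀ p : Value A, Monolithic.Germ p.Quo),
      ∃ box : I → (∀ p : Value A, Monolithic.Germ p.Quo) → ∀ p : Value A, Monolithic.Germ p.Quo,
        box i = posetBox Value.Below ∧
        ((∀ ψ ∈ Γ, (translate i ψ).eval box v = 1) → (translate i φ).eval box v = 1)) :
    GBLEntails.{u} {e | ∃ ψ ∈ Γ, e = ψ.eqOne} φ.eqOne := by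
  intro A _ v hv
  obtain ⟨box, hbox, h⟩ := H A fun p => represent (v p)
  refine represent_injective_one ?_
  simp only [eval_translate_represent i hbox] at h
  refine h fun ψ hψ => ?_
  have h1 : ψ.eval (fun e : Empty => e.elim) v = 1 := hv _ ⟨ψ, hψ, rfl⟩
  rw [h1, represent_one]

theorem GBLEntails_iff_S4MVEntails (Γ : Set FmL) (φ : FmL) :
    GBLEntails.{u} {e | ∃ ψ ∈ Γ, e = ψ.eqOne} φ.eqOne ↔
      S4MVEntails.{u} {e | ∃ ψ ∈ Γ, e = (M ψ).eqOne} (M φ).eqOne := by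
  refine ⟨fun H A _ box h v hv => ?_, fun H => GBLEntails_of_translate MonoConn.box fun A _ v => ?_⟩
  · exact holds_translate_of_GBLEntails H h _ v fun ψ hψ => hv _ ⟨ψ, hψ, rfl⟩
  · refine ⟨fun _ => posetBox Value.Below, rfl, fun hv => ?_⟩
    refine H _ _ (isS4MVI_posetBox (r := fun _ => Value.Below) fun _ _ _ _ h k => h.trans k) v ?_
    rintro _ ⟨ψ, hψ, rfl⟩
    exact hv ψ hψ

theorem GBLEntails_iff_S4tMVEntails (Γ : Set FmL) (φ : FmL) :
    GBLEntails.{u} {e | ∃ ψ ∈ Γ, e = ψ.eqOne} φ.eqOne ↔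
      S4tMVEntails.{u} {e | ∃ ψ ∈ Γ, e = (T ψ).eqOne} (T φ).eqOne := by
  refine ⟨fun H A _ box h v hv => ?_, fun H => GBLEntails_of_translate TenseConn.G fun A _ v => ?_⟩
  · exact holds_translate_of_GBLEntails H h.toIsS4MVI _ v fun ψ hψ => hv _ ⟨ψ, hψ, rfl⟩
  · refine ⟨fun n => posetBox (tenseRel Value.Below n), rfl, fun hv => ?_⟩
    refine H _ _ (isS4tMV_posetBox (r := Value.Below) fun _ _ _ h k => h.trans k) v ?_
    rintro _ ⟨ψ, hψ, rfl⟩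
    exact hv ψ hψ

/-! ## Soundness -/

section Soundness

variable {I : Type}

theorem Derives.eval_eq_one {Ax : Fm I → Prop} {Γ : Set (Fm I)} {φ : Fm I} {A : Type u} [BCIRL A]
    {box : I → A → A} {v : ℕ → A} (hbox : ∀ i, box i 1 = 1)
    (hAx : ∀ ψ, Ax ψ → ψ.eval box v = 1) (hΓ : ∀ ψ ∈ Γ, ψ.eval box v = 1) (h : Derives Ax Γ φ) :
    φ.eval box v = 1 := by
  induction h with
  | ax h => exact hAx _ h
  | hyp h => exact hΓ _ h
  | mp _ _ h k =>
    have := imp_eq_one.1 k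
    exact eq_one_of_one_le (h.ge.trans this)
  | nec i _ h => exact (congrArg (box i) h).trans (hbox i)

theorem GBLAxiom.eval_eq_one {φ : Fm I} {A : Type u} [GBLAlgebra A] (box : I → A → A) (v : ℕ → A)
    (h : GBLAxiom φ) : φ.eval box v = 1 := by
  cases h <;> simp only [Fm.eval, imp_eq_one]
  case a1 => exact le_rfl
  case a2 => rw [← mul_le_iff]; exact imp_trans_le _ _ _
  case a3 => exact (mul_comm _ _).le
  case a4 => exact mul_le_right _ _
  case a5 => rw [mul_imp]
  case a6 => rw [mul_imp]
  case a7 => rw [mul_imp_self]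
  case a8 => rw [mul_imp_self]
  case a9 => rw [inf_comm]
  case a10 => exact le_sup_left
  case a11 => exact le_sup_right
  case a12 => rw [sup_imp]
  case a13 => exact bot_le

theorem LukAxiom.eval_eq_one {φ : Fm I} {A : Type u} [MVAlgebra A] (box : I → A → A) (v : ℕ → A)
    (h : LukAxiom φ) : φ.eval box v = 1 := by
  cases h with
  | gbl h => exact h.eval_eq_one box v
  | a14 φ ψ => exact BLAlgebra.prelinearity _ _
  | a15 φ =>
    simp only [Fm.eval, Fm.iff, Fm.neg, MVAlgebra.neg_neg, imp_self_eq, inf_idem]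

theorem S4LukAxiom.eval_eq_one {φ : Fm I} {A : Type u} [MVAlgebra A] {box : I → A → A}
    (hbox : IsS4MVI box) (v : ℕ → A) (h : S4LukAxiom φ) : φ.eval box v = 1 := by
  cases h with
  | modal h =>
    cases h with
    | luk h => exact h.eval_eq_one box v
    | axK i φ ψ =>
      simp only [Fm.eval, imp_eq_one]
      rw [← mul_le_iff, ← hbox.map_mul]
      exact hbox.monotone i (imp_mul_le _ _)
    | axP => simp only [Fm.eval, Fm.iff, hbox.map_mul, imp_self_eq, inf_idem]
    | axM => simp only [Fm.eval, Fm.iff, hbox.map_inf, imp_self_eq, inf_idem]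
    | ax1 => simp only [Fm.eval, Fm.iff, hbox.map_one, imp_self_eq, inf_idem]
    | ax0 => simp only [Fm.eval, Fm.iff, hbox.map_bot, imp_self_eq, inf_idem]
  | axT i φ => exact imp_eq_one.2 (hbox.le_self i _)
  | ax4 i φ => exact imp_eq_one.2 (hbox.idem i _).ge

theorem S4tLukAxiom.eval_eq_one {φ : FmGH} {A : Type u} [MVAlgebra A] {box : TenseConn → A → A}
    (hbox : IsS4tMV box) (v : ℕ → A) (h : S4tLukAxiom φ) : φ.eval box v = 1 := by
  cases h with
  | s4 h => exact h.eval_eq_one hbox.toIsS4MVI v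
  | axGP φ => exact imp_eq_one.2 ((hbox.residual _ _).2 le_rfl)
  | axHF φ =>
    -- The residuation law at `G¬φ ≤ G¬φ` gives `¬H¬G¬φ ≤ ¬φ`; contraposition yields the axiom.
    have h1 := (hbox.residual (box .G (φ.eval box v ⇨ ⊥)) _).1 le_rfl
    have h2 := imp_anti_left h1 ⊥
    rw [MVAlgebra.neg_neg, MVAlgebra.neg_neg] at h2
    exact imp_eq_one.2 h2

end Soundness

/-! ## Completeness -/

namespace Derives

open Fm

variable {I : Type} {Ax : Fm I → Prop} {Γ : Set (Fm I)}

section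

variable (hAx : ∀ φ, GBLAxiom φ → Ax φ)
include hAx

theorem gbl {φ : Fm I} (h : GBLAxiom φ) : Derives Ax Γ φ := .ax (hAx φ h)

theorem imp_trans {φ ψ χ : Fm I} (h : Derives Ax Γ (imp φ ψ)) (k : Derives Ax Γ (imp ψ χ)) :
    Derives Ax Γ (imp φ χ) := .mp k (.mp h (gbl hAx (.a2 _ _ _)))

theorem residuation {φ ψ χ : Fm I} :
    Derives Ax Γ (imp (mul φ ψ) χ) ↔ Derives Ax Γ (imp φ (imp ψ χ)) :=
  ⟨fun h => .mp h (gbl hAx (.a6 _ _ _)), fun h => .mp h (gbl hAx (.a5 _ _ _))⟩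

theorem mul_left (φ ψ : Fm I) : Derives Ax Γ (imp (mul φ ψ) φ) :=
  imp_trans hAx (gbl hAx (.a3 _ _)) (gbl hAx (.a4 _ _))

theorem imp_mul (φ ψ : Fm I) : Derives Ax Γ (imp (mul (imp φ ψ) φ) ψ) :=
  (residuation hAx).2 (gbl hAx (.a1 _))

theorem mul_imp (φ ψ : Fm I) : Derives Ax Γ (imp (mul φ (imp φ ψ)) ψ) :=
  imp_trans hAx (gbl hAx (.a3 _ _)) (imp_mul hAx φ ψ)

theorem weaken {φ : Fm I} (χ : Fm I) (h : Derives Ax Γ φ) : Derives Ax Γ (imp χ φ) :=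
  .mp h ((residuation hAx).1 (mul_left hAx _ _))

theorem one_imp_iff {φ : Fm I} : Derives Ax Γ (imp one φ) ↔ Derives Ax Γ φ :=
  ⟨fun h => .mp (gbl hAx .truth) h, weaken hAx one⟩

theorem imp_mul_of_derives {φ : Fm I} (h : Derives Ax Γ φ) (χ : Fm I) :
    Derives Ax Γ (imp χ (mul φ χ)) := .mp h ((residuation hAx).1 (gbl hAx (.a1 _)))

theorem mul_imp_mono (φ : Fm I) {ψ χ : Fm I} (h : Derives Ax Γ (imp ψ χ)) :
    Derives Ax Γ (imp (mul φ (imp φ ψ)) (mul φ (imp φ χ))) := by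
  have h1 : Derives Ax Γ (imp (imp φ ψ) (imp φ χ)) :=
    (residuation hAx).1 (imp_trans hAx (imp_mul hAx φ ψ) h)
  have h2 : Derives Ax Γ (imp (mul (imp φ ψ) φ) (mul (imp φ χ) φ)) :=
    (residuation hAx).2 (imp_trans hAx h1 ((residuation hAx).1 (gbl hAx (.a1 _))))
  exact imp_trans hAx (gbl hAx (.a3 _ _)) (imp_trans hAx h2 (gbl hAx (.a3 _ _)))

theorem and_left (φ ψ : Fm I) : Derives Ax Γ (imp (and φ ψ) φ) :=
  imp_trans hAx (gbl hAx (.a8 _ _)) (mul_left hAx _ _)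

theorem and_right (φ ψ : Fm I) : Derives Ax Γ (imp (and φ ψ) ψ) :=
  imp_trans hAx (gbl hAx (.a8 _ _)) (mul_imp hAx _ _)

/-- Through the divisibility axioms: `χ` implies `χ·(χ→φ)`, hence `φ∧χ`, hence `φ·(φ→χ)`, hence
`φ·(φ→ψ)`, hence `φ∧ψ`. -/
theorem imp_and {φ ψ χ : Fm I} (h : Derives Ax Γ (imp χ φ)) (k : Derives Ax Γ (imp χ ψ)) :
    Derives Ax Γ (imp χ (and φ ψ)) := by
  refine imp_trans hAx (imp_mul_of_derives hAx h χ) (imp_trans hAx (gbl hAx (.a3 _ _)) ?_)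
  refine imp_trans hAx (gbl hAx (.a7 _ _)) (imp_trans hAx (gbl hAx (.a9 _ _)) ?_)
  refine imp_trans hAx (gbl hAx (.a8 _ _)) (imp_trans hAx (mul_imp_mono hAx φ k) ?_)
  exact gbl hAx (.a7 _ _)

theorem and_intro {φ ψ : Fm I} (h : Derives Ax Γ φ) (k : Derives Ax Γ ψ) :
    Derives Ax Γ (and φ ψ) :=
  (one_imp_iff hAx).1 (imp_and hAx (weaken hAx _ h) (weaken hAx _ k))

theorem iff_mp {φ ψ : Fm I} (h : Derives Ax Γ (iff φ ψ)) : Derives Ax Γ (imp φ ψ) :=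
  .mp h (and_left hAx _ _)

theorem iff_mpr {φ ψ : Fm I} (h : Derives Ax Γ (iff φ ψ)) : Derives Ax Γ (imp ψ φ) :=
  .mp h (and_right hAx _ _)

end

/-- The formulas preordered by derivability of implications. -/
abbrev pre (hAx : ∀ φ, GBLAxiom φ → Ax φ) (Γ : Set (Fm I)) : PreGBL (Fm I) where
  le φ ψ := Derives Ax Γ (imp φ ψ)
  inf := and
  sup := or
  mul := mul
  imp := imp
  bot := zero
  one := one
  refl φ := gbl hAx (.a1 φ)
  trans := imp_trans hAx
  inf_le_left := and_left hAx
  inf_le_right := and_right hAx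
  le_inf := imp_and hAx
  le_sup_left _ _ := gbl hAx (.a10 _ _)
  le_sup_right _ _ := gbl hAx (.a11 _ _)
  sup_le h k := .mp (and_intro hAx h k) (gbl hAx (.a12 _ _ _))
  bot_le φ := gbl hAx (.a13 φ)
  le_one φ := weaken hAx φ (gbl hAx .truth)
  mul_comm _ _ := gbl hAx (.a3 _ _)
  mul_assoc_le _ _ _ := (residuation hAx).2 <| (residuation hAx).2 <|
    imp_trans hAx ((residuation hAx).1 (gbl hAx (.a1 _))) (gbl hAx (.a6 _ _ _))
  mul_le_right _ _ := gbl hAx (.a4 _ _)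
  le_one_mul φ := imp_mul_of_derives hAx (gbl hAx .truth) φ
  residuation := residuation hAx
  mul_imp_le _ _ := gbl hAx (.a7 _ _)
  le_mul_imp _ _ := gbl hAx (.a8 _ _)

variable (hAx : ∀ φ, GBLAxiom φ → Ax φ)

theorem cls_eq_one {φ : Fm I} : (pre hAx Γ).cls φ = 1 ↔ Derives Ax Γ φ := by
  have key : (1 : (pre hAx Γ).Quo) ≤ (pre hAx Γ).cls φ ↔ Derives Ax Γ φ := one_imp_iff hAx
  exact ⟨fun h => key.1 h.ge, fun h => eq_one_of_one_le (key.2 h)⟩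

theorem eval_cls {box : I → (pre hAx Γ).Quo → (pre hAx Γ).Quo}
    (hbox : ∀ i φ, box i ((pre hAx Γ).cls φ) = (pre hAx Γ).cls (.box i φ)) (φ : Fm I) :
    φ.eval box (fun p => (pre hAx Γ).cls (.var p)) = (pre hAx Γ).cls φ := by
  induction φ with
  | var p => rfl
  | zero => rfl
  | one => rfl
  | and φ ψ hφ hψ => exact congrArg₂ (· ⊓ ·) hφ hψ
  | or φ ψ hφ hψ => exact congrArg₂ (· ⊔ ·) hφ hψ
  | mul φ ψ hφ hψ => exact congrArg₂ (· * ·) hφ hψ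
  | imp φ ψ hφ hψ => exact congrArg₂ (· ⇨ ·) hφ hψ
  | box i φ h => exact (congrArg (box i) h).trans (hbox i φ)

section

variable (hS : ∀ φ, S4LukAxiom φ → Ax φ)

/-- The axioms of generalized basic logic among those of an extension of `S4Ł(I)`. -/
theorem gbl_of_s4 (hS : ∀ φ, S4LukAxiom φ → Ax φ) (φ : Fm I) (h : GBLAxiom φ) : Ax φ :=
  hS φ (.modal (.luk (.gbl h)))

/-- The Lindenbaum algebra. -/
abbrev Lindenbaum (hS : ∀ φ, S4LukAxiom φ → Ax φ) (Γ : Set (Fm I)) : Type :=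
  (pre (gbl_of_s4 hS) Γ).Quo

instance : MVAlgebra (Lindenbaum hS Γ) where
  prelinearity := PreGBL.ind fun φ => PreGBL.ind fun ψ =>
    (cls_eq_one (gbl_of_s4 hS)).2 (.ax (hS _ (.modal (.luk (.a14 φ ψ)))))
  neg_neg := PreGBL.ind fun φ =>
    have h : Derives Ax Γ (iff (neg (neg φ)) φ) := .ax (hS _ (.modal (.luk (.a15 φ))))
    PreGBL.cls_eq.2 ⟨iff_mp (gbl_of_s4 hS) h, iff_mpr (gbl_of_s4 hS) h⟩

include hS in
theorem box_mono (i : I) {φ ψ : Fm I} (h : Derives Ax Γ (imp φ ψ)) :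
    Derives Ax Γ (imp (.box i φ) (.box i ψ)) := .mp (.nec i h) (.ax (hS _ (.modal (.axK i φ ψ))))

/-- The operations of the Lindenbaum algebra. -/
def lindenbaumBox (Γ : Set (Fm I)) (i : I) : Lindenbaum hS Γ → Lindenbaum hS Γ :=
  Quotient.map (.box i) fun _ _ h => ⟨box_mono hS i h.1, box_mono hS i h.2⟩

theorem cls_eq_of_iff {φ ψ : Fm I} (h : S4LukAxiom (iff φ ψ)) :
    (pre (gbl_of_s4 hS) Γ).cls φ = (pre (gbl_of_s4 hS) Γ).cls ψ :=
  have h : Derives Ax Γ (iff φ ψ) := .ax (hS _ h)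
  PreGBL.cls_eq.2 ⟨iff_mp (gbl_of_s4 hS) h, iff_mpr (gbl_of_s4 hS) h⟩

theorem isS4MVI_lindenbaum : IsS4MVI (lindenbaumBox hS Γ) where
  map_inf i := PreGBL.ind fun φ => PreGBL.ind fun ψ => cls_eq_of_iff hS (.modal (.axM i φ ψ))
  map_mul i := PreGBL.ind fun φ => PreGBL.ind fun ψ => cls_eq_of_iff hS (.modal (.axP i φ ψ))
  map_bot i := cls_eq_of_iff hS (.modal (.ax0 i))
  map_one i := cls_eq_of_iff hS (.modal (.ax1 i))
  monotone i := PreGBL.ind fun _ => PreGBL.ind fun _ h => box_mono hS i h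
  le_self i := PreGBL.ind fun φ => .ax (hS _ (.axT i φ))
  idem i := PreGBL.ind fun φ => PreGBL.cls_eq.2 ⟨.ax (hS _ (.axT i _)), .ax (hS _ (.ax4 i φ))⟩

theorem eval_lindenbaum (φ : Fm I) :
    φ.eval (lindenbaumBox hS Γ) (fun p => (pre (gbl_of_s4 hS) Γ).cls (.var p)) =
      (pre (gbl_of_s4 hS) Γ).cls φ := eval_cls _ (fun _ _ => rfl) φ

theorem eval_lindenbaum_eq_one {φ : Fm I} :
    φ.eval (lindenbaumBox hS Γ) (fun p => (pre (gbl_of_s4 hS) Γ).cls (.var p)) = 1 ↔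
      Derives Ax Γ φ := by
  rw [eval_lindenbaum]
  exact cls_eq_one _

end

theorem isS4tMV_lindenbaum {Γ : Set FmGH} :
    IsS4tMV (lindenbaumBox (Ax := S4tLukAxiom) (fun _ => .s4) Γ) where
  toIsS4MVI := isS4MVI_lindenbaum _
  residual := by
    set box := lindenbaumBox (Ax := S4tLukAxiom) (fun _ => .s4) Γ
    have hm (i) : Monotone (box i) := (isS4MVI_lindenbaum _).monotone i
    have hGP : ∀ x, x ≤ box .G (box .H (x ⇨ ⊥) ⇨ ⊥) :=
      PreGBL.ind fun φ => Derives.ax (S4tLukAxiom.axGP φ)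
    have hHF : ∀ x, x ≤ box .H (box .G (x ⇨ ⊥) ⇨ ⊥) :=
      PreGBL.ind fun φ => Derives.ax (S4tLukAxiom.axHF φ)
    refine fun x y => ⟨fun h => ?_, fun h => (hGP x).trans (hm .G h)⟩
    -- From `¬y ≤ H¬Gy ≤ H¬x`, contraposition gives `¬H¬x ≤ y`.
    have h1 := hHF (y ⇨ ⊥)
    rw [MVAlgebra.neg_neg] at h1
    have h2 := imp_anti_left (h1.trans (hm .H (imp_anti_left h ⊥))) ⊥
    rwa [MVAlgebra.neg_neg] at h2

end Derives

/-! ### Strong completeness of the three calculi. -/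

theorem GBLDerives_iff (Γ : Set FmL) (φ : FmL) :
    GBLDerives Γ φ ↔ GBLEntails.{0} {e | ∃ ψ ∈ Γ, e = ψ.eqOne} φ.eqOne := by
  refine ⟨fun h A _ v hv => ?_, fun h => ?_⟩
  · exact h.eval_eq_one (fun i => i.elim) (fun _ h => h.eval_eq_one _ v)
      fun ψ hψ => hv _ ⟨ψ, hψ, rfl⟩
  · have key (ψ) := Derives.eval_cls (Γ := Γ) (fun (ψ : FmL) (h : GBLAxiom ψ) => h)
      (box := fun e => e.elim) (fun e => e.elim) ψ
    refine (Derives.cls_eq_one fun (ψ : FmL) (h : GBLAxiom ψ) => h).1 ?_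
    refine (key φ).symm.trans (h _ _ ?_)
    rintro _ ⟨ψ, hψ, rfl⟩
    exact (key ψ).trans ((Derives.cls_eq_one _).2 (.hyp hψ))

theorem S4LukDerives_iff (Γ : Set FmL) (φ : FmBox) :
    S4LukDerives (M '' Γ) φ ↔ S4MVEntails.{0} {e | ∃ ψ ∈ Γ, e = (M ψ).eqOne} φ.eqOne := by
  refine ⟨fun h A _ box hbox v hv => ?_, fun h => ?_⟩
  · refine h.eval_eq_one hbox.map_one (fun _ h => h.eval_eq_one hbox v) ?_
    rintro _ ⟨ψ, hψ, rfl⟩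
    exact hv _ ⟨ψ, hψ, rfl⟩
  · refine (Derives.eval_lindenbaum_eq_one fun _ h => h).1
      (h _ _ (Derives.isS4MVI_lindenbaum _) _ ?_)
    rintro _ ⟨ψ, hψ, rfl⟩
    exact (Derives.eval_lindenbaum_eq_one _).2 (.hyp ⟨ψ, hψ, rfl⟩)

theorem S4tLukDerives_iff (Γ : Set FmL) (φ : FmGH) :
    S4tLukDerives (T '' Γ) φ ↔ S4tMVEntails.{0} {e | ∃ ψ ∈ Γ, e = (T ψ).eqOne} φ.eqOne := by
  refine ⟨fun h A _ box hbox v hv => ?_, fun h => ?_⟩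
  · refine h.eval_eq_one hbox.map_one (fun _ h => h.eval_eq_one hbox v) ?_
    rintro _ ⟨ψ, hψ, rfl⟩
    exact hv _ ⟨ψ, hψ, rfl⟩
  · refine (Derives.eval_lindenbaum_eq_one fun _ h => .s4 h).1
      (h _ _ Derives.isS4tMV_lindenbaum _ ?_)
    rintro _ ⟨ψ, hψ, rfl⟩
    exact (Derives.eval_lindenbaum_eq_one _).2 (.hyp ⟨ψ, hψ, rfl⟩)

end ModalGBL

theorem mainTheorem1 (Γ : Set ModalGBL.FmL) (φ : ModalGBL.FmL) :
    (ModalGBL.GBLEntails.{u} {e | ∃ ψ ∈ Γ, e = ψ.eqOne} φ.eqOne ↔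
      ModalGBL.S4MVEntails.{u} {e | ∃ ψ ∈ Γ, e = (ModalGBL.M ψ).eqOne} (ModalGBL.M φ).eqOne) ∧
    (ModalGBL.GBLDerives Γ φ ↔
      ModalGBL.S4LukDerives (ModalGBL.M '' Γ) (ModalGBL.M φ)) ∧
    (ModalGBL.GBLEntails.{u} {e | ∃ ψ ∈ Γ, e = ψ.eqOne} φ.eqOne ↔
      ModalGBL.S4tMVEntails.{u} {e | ∃ ψ ∈ Γ, e = (ModalGBL.T ψ).eqOne} (ModalGBL.T φ).eqOne) ∧
    (ModalGBL.GBLDerives Γ φ ↔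
      ModalGBL.S4tLukDerives (ModalGBL.T '' Γ) (ModalGBL.T φ)) := by
  open ModalGBL in
  exact ⟨GBLEntails_iff_S4MVEntails Γ φ,
    -- The algebraic equivalence is used here in universe `0`, where the Lindenbaum algebras live,
    -- and not in `u`.
    (GBLDerives_iff Γ φ).trans
      ((GBLEntails_iff_S4MVEntails Γ φ).trans (S4LukDerives_iff Γ (M φ)).symm),
    GBLEntails_iff_S4tMVEntails Γ φ,
    (GBLDerives_iff Γ φ).trans
      ((GBLEntails_iff_S4tMVEntails Γ φ).trans (S4tLukDerives_iff Γ (T φ)).symm)⟩
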